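/- Let $\Bbbk$ be an algebraically closed field of characteristic $0$ and put $(\lambda_0,\dots,\lambda_4)=(1,1,1,1,\tfrac1{16})$. Let $H\subset\{\sum_a y_a=0\}\cong\mathbb P^3$ be the quartic surface obtained from $\sum_a \frac1{\lambda_a y_a}=0$ by clearing denominators, let $x=(1:1:1:1:-4)$, an ordinary node of $H$, and let $C$ be the projectivized tangent cone of $H$ at $x$, a smooth conic in $\mathbb P(T_x\mathbb P^3)$. Equivalently, $C$ is the exceptional curve over $x$ in the minimal resolution $X$ of $H$. The involution of $X$ induced by $y_a\mapsto 1/(\lambda_a y_a)$ fixes this curve pointwise, and $C$ is thereby identified with the branch curve in the Coble surface $S$, the quotient of $X$ by this involution. For $a\ne b$ in $\{0,\dots,4\}$ let $P_{ab}$ be the point of $H$ all of whose coordinates other than $y_a,y_b$ vanish. Projection of $H$ from $P_{ab}$ has degree $2$ and defines a birational involution of $H$, which exchanges the two points other than $P_{ab}$ in which a general line through $P_{ab}$ meets $H$. It is regular at $x$ and fixes $x$, and its differential at $x$ induces a transformation $\bar g_{ab}=\bar g_{ba}$ of $C$. Let $\bar G\subset\operatorname{Aut}(C)$ be the group generated by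 the ten $\bar g_{ab}$. Let $\mathcal H$ be the ring of Hurwitz integers, that is, the $\mathbb Z$-span of $\pm1,\pm i,\pm j,\pm k,\frac12(\pm1\pm i\pm j\pm k)$ in Hamilton's quaternion algebra over $\mathbb Q$. Let $\mathbf F$ be the functor $R\mapsto \operatorname{Aut}_{R\text{-alg}}(\mathcal H\otimes_{\mathbb Z} R)$ on commutative rings. For a field $K$ of characteristic $0$, an isomorphism $\psi:\mathcal H\otimes K\cong M_2(K)$ gives an isomorphism $\mathbf F(K)\cong\operatorname{Aut}(M_2(K))\cong \operatorname{PGL}_2(K)$, and hence a homomorphism $j_\psi:\mathbf F(\mathbb Z[\frac13])\to\mathbf F(K)\cong\operatorname{PGL}_2(K)$. **Theorem.** The transformations $\bar g_{ab}$ of $C$ are well defined, and isomorphisms $\mathcal H\otimes\Bbbk\cong M_2(\Bbbk)$ and $\mathcal H\otimes\mathbb Q_3\cong M_2(\mathbb Q_3)$ exist. For every isomorphism $\psi:\mathcal H\otimes\Bbbk\cong M_2(\Bbbk)$ there is an isomorphism $\mathbb P^1\cong C$ with the following properties. 1. Under the induced isomorphism $\operatorname{Aut}(C)\cong\operatorname{PGL}_2(\Bbbk)$,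 the $\bar g_{a4}$ ($a\neq4$) correspond to the images in $\operatorname{PGL}_2(\Bbbk)$ of the quaternions $\pm i\pm j\pm k$, and the $\bar g_{ab}$ with $a,b\ne4$ correspond to the images of $\pm i\pm j$, $\pm j\pm k$, $\pm k\pm i$. 2. Under this identification $\bar G$ coincides with $\mathbf F(\mathbb Z[\frac13])$: there is an isomorphism $e:\bar G\to\mathbf F(\mathbb Z[\frac13])$ such that each $g\in\bar G$ corresponds to $j_\psi(e(g))\in\operatorname{PGL}_2(\Bbbk)$. 3. For every isomorphism $\psi_3:\mathcal H\otimes\mathbb Q_3\cong M_2(\mathbb Q_3)$, the homomorphism $j_{\psi_3}$ is injective, and the image of $\bar G$ under $j_{\psi_3}\circ e$, which is the image of $\mathbf F(\mathbb Z[\frac13])$, is maximal among the discrete subgroups of $\operatorname{PGL}_2(\mathbb Q_3)$. -/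

import Mathlib

open scoped TensorProduct Quaternion LinearAlgebra.Projectivization MatrixGroups DualNumber

noncomputable section

namespace CobleHessian

/-! ### The Hurwitz quaternions and the group functor `R ↦ Aut (ℋ ⊗ R)` -/

/-- The rational quaternion `a + b i + c j + d k`. -/
def quat (a b c d : ℚ) : ℍ[ℚ] := ⟨a, b, c, d⟩

@[simp] theorem quat_re (a b c d : ℚ) : (quat a b c d).re = a := rfl
@[simp] theorem quat_imI (a b c d : ℚ) : (quat a b c d).imI = b := rfl
@[simp] theorem quat_imJ (a b c d : ℚ) : (quat a b c d).imJ = c := rfl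
@[simp] theorem quat_imK (a b c d : ℚ) : (quat a b c d).imK = d := rfl

/-- The 24 quaternions `±1, ±i, ±j, ±k, (±1 ± i ± j ± k)/2`. -/
def hurwitzUnits : Set ℍ[ℚ] :=
  {quat 1 0 0 0, quat (-1) 0 0 0, quat 0 1 0 0, quat 0 (-1) 0 0,
    quat 0 0 1 0, quat 0 0 (-1) 0, quat 0 0 0 1, quat 0 0 0 (-1)} ∪
  {q | (q.re = 1 / 2 ∨ q.re = -1 / 2) ∧ (q.imI = 1 / 2 ∨ q.imI = -1 / 2) ∧
    (q.imJ = 1 / 2 ∨ q.imJ = -1 / 2) ∧ (q.imK = 1 / 2 ∨ q.imK = -1 / 2)}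

/-- The `ℤ`-span of the 24 units consists of the quaternions
`a + b i + c j + d k + e (1 + i + j + k)/2` with `a, b, c, d, e ∈ ℤ`. -/
theorem mem_span_hurwitzUnits {q : ℍ[ℚ]} :
    q ∈ Submodule.span ℤ hurwitzUnits ↔
      ∃ a b c d e : ℤ, q = quat (a + e / 2) (b + e / 2) (c + e / 2) (d + e / 2) := by
  constructor
  · intro h
    induction h using Submodule.span_induction with
    | mem x hx =>
      rcases hx with hx | ⟨h0, h1, h2, h3⟩
      · simp only [Set.mem_insert_iff, Set.mem_singleton_iff] at hx
        rcases hx with h | h | h | h | h | h | h | h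
        · exact ⟨1, 0, 0, 0, 0, by rw [h]; ext <;> simp⟩
        · exact ⟨-1, 0, 0, 0, 0, by rw [h]; ext <;> simp⟩
        · exact ⟨0, 1, 0, 0, 0, by rw [h]; ext <;> simp⟩
        · exact ⟨0, -1, 0, 0, 0, by rw [h]; ext <;> simp⟩
        · exact ⟨0, 0, 1, 0, 0, by rw [h]; ext <;> simp⟩
        · exact ⟨0, 0, -1, 0, 0, by rw [h]; ext <;> simp⟩
        · exact ⟨0, 0, 0, 1, 0, by rw [h]; ext <;> simp⟩
        · exact ⟨0, 0, 0, -1, 0, by rw [h]; ext <;> simp⟩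
      · have key : ∀ r : ℚ, (r = 1 / 2 ∨ r = -1 / 2) → ∃ a : ℤ, r = a + ((1 : ℤ) : ℚ) / 2 := by
          rintro r (h | h)
          · exact ⟨0, by rw [h]; norm_num⟩
          · exact ⟨-1, by rw [h]; norm_num⟩
        obtain ⟨a, ha⟩ := key _ h0
        obtain ⟨b, hb⟩ := key _ h1
        obtain ⟨c, hc⟩ := key _ h2
        obtain ⟨d, hd⟩ := key _ h3
        exact ⟨a, b, c, d, 1, by ext <;> assumption⟩
    | zero => exact ⟨0, 0, 0, 0, 0, by ext <;> simp⟩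
    | add x y _ _ hx hy =>
      obtain ⟨a, b, c, d, e, rfl⟩ := hx
      obtain ⟨a', b', c', d', e', rfl⟩ := hy
      refine ⟨a + a', b + b', c + c', d + d', e + e', ?_⟩
      ext <;> simp <;> ring
    | smul n x _ hx =>
      obtain ⟨a, b, c, d, e, rfl⟩ := hx
      refine ⟨n * a, n * b, n * c, n * d, n * e, ?_⟩
      ext <;> simp <;> ring
  · rintro ⟨a, b, c, d, e, rfl⟩
    have h1 : (quat 1 0 0 0 : ℍ[ℚ]) ∈ Submodule.span ℤ hurwitzUnits :=
      Submodule.subset_span (Or.inl (by simp))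
    have hi : (quat 0 1 0 0 : ℍ[ℚ]) ∈ Submodule.span ℤ hurwitzUnits :=
      Submodule.subset_span (Or.inl (by simp))
    have hj : (quat 0 0 1 0 : ℍ[ℚ]) ∈ Submodule.span ℤ hurwitzUnits :=
      Submodule.subset_span (Or.inl (by simp))
    have hk : (quat 0 0 0 1 : ℍ[ℚ]) ∈ Submodule.span ℤ hurwitzUnits :=
      Submodule.subset_span (Or.inl (by simp))
    have hw : (quat (1 / 2) (1 / 2) (1 / 2) (1 / 2) : ℍ[ℚ]) ∈ Submodule.span ℤ hurwitzUnits :=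
      Submodule.subset_span (Or.inr (by simp))
    have := add_mem (add_mem (add_mem (add_mem (Submodule.smul_mem _ a h1)
      (Submodule.smul_mem _ b hi)) (Submodule.smul_mem _ c hj)) (Submodule.smul_mem _ d hk))
      (Submodule.smul_mem _ e hw)
    convert this using 1
    ext <;> simp <;> ring

/-- The Hurwitz integers `ℋ`: the `ℤ`-span of the 24 units, a subring of Hamilton's quaternion
algebra over `ℚ`. -/
def Hurwitz : Subring ℍ[ℚ] where
  carrier := Submodule.span ℤ hurwitzUnits
  mul_mem' := by
    intro x y hx hy
    obtain ⟨a, b, c, d, e, rfl⟩ := mem_span_hurwitzUnits.1 hx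
    obtain ⟨a', b', c', d', e', rfl⟩ := mem_span_hurwitzUnits.1 hy
    refine mem_span_hurwitzUnits.2
      ⟨a * a' - b * b' - c * c' - d * d',
       a * b' + b * a' + c * d' - d * c' + e' * (b + c) + e * (b' + d') + e * e',
       a * c' - b * d' + c * a' + d * b' + e' * (c + d) + e * (b' + c') + e * e',
       a * d' + b * c' - c * b' + d * a' + e' * (b + d) + e * (c' + d') + e * e',
       e' * (a - b - c - d) + e * (a' - b' - c' - d') - e * e', ?_⟩
    ext <;> simp <;> ring
  one_mem' := Submodule.subset_span (Or.inl (by left; ext <;> simp))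
  add_mem' := fun hx hy => add_mem hx hy
  zero_mem' := Submodule.zero_mem _
  neg_mem' := fun hx => neg_mem hx

/-- `F(R)`, the group of `R`-algebra automorphisms of `R ⊗ ℋ`. -/
abbrev F (R : Type*) [CommRing R] : Type _ := (R ⊗[ℤ] Hurwitz) ≃ₐ[R] (R ⊗[ℤ] Hurwitz)

/-- The ring homomorphism `R ⊗ ℋ → S ⊗ ℋ` induced by `f : R → S`. -/
def extend {R S : Type*} [CommRing R] [CommRing S] (f : R →+* S) :
    R ⊗[ℤ] Hurwitz →ₐ[ℤ] S ⊗[ℤ] Hurwitz :=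
  Algebra.TensorProduct.map f.toIntAlgHom (AlgHom.id ℤ Hurwitz)

/-- The base change along `f : R → S` of an `R`-algebra endomorphism `σ` of `R ⊗ ℋ`:
the `S`-algebra endomorphism of `S ⊗ ℋ` sending `s ⊗ h` to `s` times the image of `σ (1 ⊗ h)`. -/
def baseChange {R S : Type*} [CommRing R] [CommRing S] (f : R →+* S)
    (σ : R ⊗[ℤ] Hurwitz →ₐ[R] R ⊗[ℤ] Hurwitz) : S ⊗[ℤ] Hurwitz →ₐ[S] S ⊗[ℤ] Hurwitz :=
  Algebra.TensorProduct.lift (Algebra.ofId S _)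
    ((extend f).comp ((σ.restrictScalars ℤ).comp Algebra.TensorProduct.includeRight))
    (fun s _ => Algebra.commutes s _)

theorem baseChange_extend {R S : Type*} [CommRing R] [CommRing S] (f : R →+* S)
    (σ : R ⊗[ℤ] Hurwitz →ₐ[R] R ⊗[ℤ] Hurwitz) (x : R ⊗[ℤ] Hurwitz) :
    baseChange f σ (extend f x) = extend f (σ x) := by
  induction x using TensorProduct.induction_on with
  | zero => simp
  | add x y hx hy => simp only [map_add, hx, hy]
  | tmul r h =>
    have h1 : r ⊗ₜ[ℤ] h = (r ⊗ₜ[ℤ] (1 : Hurwitz)) * ((1 : R) ⊗ₜ[ℤ] h) := by simp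
    have h2 : σ (r ⊗ₜ[ℤ] (1 : Hurwitz)) = r ⊗ₜ[ℤ] (1 : Hurwitz) := σ.commutes r
    have h3 : baseChange f σ (extend f (r ⊗ₜ[ℤ] h)) =
        (f r ⊗ₜ[ℤ] (1 : Hurwitz)) * extend f (σ ((1 : R) ⊗ₜ[ℤ] h)) := rfl
    rw [h3, h1, map_mul, map_mul, h2]
    rfl

theorem baseChange_tmul {R S : Type*} [CommRing R] [CommRing S] (f : R →+* S)
    (σ : R ⊗[ℤ] Hurwitz →ₐ[R] R ⊗[ℤ] Hurwitz) (h : Hurwitz) :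
    baseChange f σ ((1 : S) ⊗ₜ h) = extend f (σ (1 ⊗ₜ h)) := by
  rw [← baseChange_extend]
  simp [extend]

theorem baseChange_id {R S : Type*} [CommRing R] [CommRing S] (f : R →+* S) :
    baseChange f (AlgHom.id R _) = AlgHom.id S _ := by
  ext h
  simp [baseChange_tmul, extend]

theorem baseChange_comp {R S : Type*} [CommRing R] [CommRing S] (f : R →+* S)
    (σ τ : R ⊗[ℤ] Hurwitz →ₐ[R] R ⊗[ℤ] Hurwitz) :
    baseChange f (σ.comp τ) = (baseChange f σ).comp (baseChange f τ) := by
  ext h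
  simp [baseChange_tmul, baseChange_extend]

/-- The homomorphism `F(R) → F(S)` induced by a ring homomorphism `R → S`. -/
def F.map {R S : Type*} [CommRing R] [CommRing S] (f : R →+* S) : F R →* F S where
  toFun σ := AlgEquiv.ofAlgHom (baseChange f σ) (baseChange f σ.symm)
    (by rw [← baseChange_comp]; simpa using baseChange_id f)
    (by rw [← baseChange_comp]; simpa using baseChange_id f)
  map_one' := by
    apply AlgEquiv.ext
    intro x
    exact congrArg (fun g => g x) (baseChange_id f)
  map_mul' σ τ := by
    apply AlgEquiv.ext
    intro x
    exact congrArg (fun g => g x) (baseChange_comp f (σ : _ →ₐ[R] _) (τ : _ →ₐ[R] _))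

/-- The ring `ℤ[1/3]`. -/
abbrev ZThird : Type := Localization.Away (3 : ℤ)

/-- The ring homomorphism from `ℤ[1/3]` to a field of characteristic zero. -/
def ZThird.toField (K : Type*) [Field K] [CharZero K] : ZThird →+* K :=
  IsLocalization.Away.lift (S := ZThird) (g := Int.castRingHom K) (3 : ℤ)
    (isUnit_iff_ne_zero.2 (by norm_num))

/-! ### `PGL₂` -/

/-- The quotient topology on `PGL₂(K)`. -/
instance {K : Type*} [Field K] [TopologicalSpace K] : TopologicalSpace PGL(2, K) :=
  TopologicalSpace.coinduced (Matrix.ProjGenLinGroup.mk : GL (Fin 2) K → PGL(2, K)) inferInstance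

/-- `2 × 2` matrices. -/
abbrev M₂ (K : Type*) : Type _ := Matrix (Fin 2) (Fin 2) K

/-- Conjugation by an invertible matrix, as an automorphism of the matrix algebra. -/
def conjGL (K : Type*) [Field K] : GL (Fin 2) K →* (M₂ K ≃ₐ[K] M₂ K) where
  toFun A := AlgEquiv.ofAlgHom
    { toFun := fun X => (A : M₂ K) * X * ((A⁻¹ : GL (Fin 2) K) : M₂ K)
      map_one' := by simp
      map_mul' := fun X Y => by simp [mul_assoc]
      map_zero' := by simp
      map_add' := fun X Y => by rw [mul_add, add_mul]
      commutes' := fun r => by rw [← Algebra.commutes, mul_assoc]; simp }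
    { toFun := fun X => ((A⁻¹ : GL (Fin 2) K) : M₂ K) * X * (A : M₂ K)
      map_one' := by simp
      map_mul' := fun X Y => by simp [mul_assoc]
      map_zero' := by simp
      map_add' := fun X Y => by rw [mul_add, add_mul]
      commutes' := fun r => by rw [← Algebra.commutes, mul_assoc]; simp }
    (by ext1 X; simp [mul_assoc])
    (by ext1 X; simp [mul_assoc])
  map_one' := by ext1 X; simp
  map_mul' A B := by ext1 X; simp [mul_assoc]

@[simp] theorem conjGL_apply {K : Type*} [Field K] (A : GL (Fin 2) K) (X : M₂ K) :
    conjGL K A X = (A : M₂ K) * X * ((A⁻¹ : GL (Fin 2) K) : M₂ K) := rfl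

/-- The homomorphism `PGL₂(K) → Aut(M₂(K))`, `[A] ↦ (X ↦ A X A⁻¹)`. -/
def conjPGL (K : Type*) [Field K] : PGL(2, K) →* (M₂ K ≃ₐ[K] M₂ K) :=
  Matrix.ProjGenLinGroup.lift (conjGL K) (by
    apply MonoidHom.ext
    intro u
    apply AlgEquiv.ext
    intro X
    have h : ((Matrix.GeneralLinearGroup.scalar (Fin 2) u : GL (Fin 2) K) : M₂ K) * X =
        X * ((Matrix.GeneralLinearGroup.scalar (Fin 2) u : GL (Fin 2) K) : M₂ K) :=
      (Matrix.scalar_commute (u : K) (fun r => mul_comm _ _) X).eq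
    simp only [MonoidHom.comp_apply, conjGL_apply, MonoidHom.one_apply, AlgEquiv.one_apply]
    rw [h, mul_assoc, Units.mul_inv, mul_one])

/-- Automorphisms of `M₂(K)` are inner. -/
theorem conjPGL_bijective (K : Type*) [Field K] : Function.Bijective (conjPGL K) := by
  constructor
  · rw [injective_iff_map_eq_one]
    intro g hg
    induction g using Matrix.ProjGenLinGroup.induction_on with
    | mk A =>
      rw [Matrix.ProjGenLinGroup.mk_eq_one, Subgroup.mem_center_iff]
      intro B
      have h : (A : M₂ K) * (B : M₂ K) * ((A⁻¹ : GL (Fin 2) K) : M₂ K) = B :=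
        congrArg (fun g => g (B : M₂ K)) hg
      have h' : A * B * A⁻¹ = B := Units.ext h
      rw [mul_inv_eq_iff_eq_mul] at h'
      exact h'.symm
  · intro f
    let L : M₂ K ≃ₐ[K] Module.End K (Fin 2 → K) := Matrix.toLinAlgEquiv'
    obtain ⟨T, hT⟩ := AlgEquiv.eq_linearEquivConjAlgEquiv ((L.symm.trans f).trans L)
    let A : GL (Fin 2) K := ⟨L.symm T.toLinearMap, L.symm T.symm.toLinearMap,
      by
        rw [← map_mul, ← map_one L.symm]
        congr 1
        exact LinearMap.ext fun x => T.apply_symm_apply x,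
      by
        rw [← map_mul, ← map_one L.symm]
        congr 1
        exact LinearMap.ext fun x => T.symm_apply_apply x⟩
    refine ⟨Matrix.ProjGenLinGroup.mk A, ?_⟩
    apply AlgEquiv.ext
    intro X
    apply L.injective
    have h1 := congrArg (fun g => g (L X)) hT
    simp only [AlgEquiv.trans_apply, AlgEquiv.symm_apply_apply] at h1
    rw [h1]
    change L (L.symm T.toLinearMap * X * L.symm T.symm.toLinearMap) = _
    rw [map_mul, map_mul, AlgEquiv.apply_symm_apply, AlgEquiv.apply_symm_apply]
    rfl

/-- For an isomorphism `ψ : K ⊗ ℋ ≅ M₂(K)`, the resulting isomorphism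
`F(K) ≅ Aut(M₂(K)) ≅ PGL₂(K)`. -/
def FEquivPGL {K : Type*} [Field K] (ψ : K ⊗[ℤ] Hurwitz ≃ₐ[K] M₂ K) : F K ≃* PGL(2, K) :=
  (AlgEquiv.autCongr ψ).trans (MulEquiv.ofBijective (conjPGL K) (conjPGL_bijective K)).symm

/-- The homomorphism `F(ℤ[1/3]) → F(K) ≅ PGL₂(K)`. -/
def toPGL {K : Type*} [Field K] [CharZero K] (ψ : K ⊗[ℤ] Hurwitz ≃ₐ[K] M₂ K) :
    F ZThird →* PGL(2, K) :=
  (FEquivPGL ψ).toMonoidHom.comp (F.map (ZThird.toField K))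

/-- The action of `GL₂(K)` on the points of the projective line. -/
def glPerm (K : Type*) [Field K] : GL (Fin 2) K →* Equiv.Perm (ℙ K (Fin 2 → K)) :=
  (MulAction.toPermHom (LinearMap.GeneralLinearGroup K (Fin 2 → K)) (ℙ K (Fin 2 → K))).comp
    (Matrix.GeneralLinearGroup.toLin : GL (Fin 2) K ≃* _).toMonoidHom

theorem glPerm_mk {K : Type*} [Field K] (A : GL (Fin 2) K) (u : Fin 2 → K) (hu : u ≠ 0)
    (hu' : (A : M₂ K).mulVec u ≠ 0) :
    glPerm K A (Projectivization.mk K u hu) =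
      Projectivization.mk K ((A : M₂ K).mulVec u) hu' := rfl

/-- The action of `PGL₂(K)` on the points of the projective line. -/
def pglPerm (K : Type*) [Field K] : PGL(2, K) →* Equiv.Perm (ℙ K (Fin 2 → K)) :=
  Matrix.ProjGenLinGroup.lift (glPerm K) (by
    apply MonoidHom.ext
    intro c
    apply Equiv.ext
    intro p
    induction p using Projectivization.ind with
    | h u hu =>
      have h : ((Matrix.GeneralLinearGroup.scalar (Fin 2) c : GL (Fin 2) K) : M₂ K).mulVec u
          = (c : K) • u := by
        change (Matrix.scalar (Fin 2) (c : K)).mulVec u = _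
        simp [Matrix.scalar_apply, ← Matrix.smul_one_eq_diagonal, Matrix.smul_mulVec]
      have hne : ((Matrix.GeneralLinearGroup.scalar (Fin 2) c : GL (Fin 2) K) : M₂ K).mulVec u
          ≠ 0 := by
        rw [h]
        exact smul_ne_zero c.ne_zero hu
      rw [MonoidHom.comp_apply, glPerm_mk _ u hu hne]
      exact (Projectivization.mk_eq_mk_iff' K _ _ hne hu).2 ⟨c, h.symm⟩)

/-! ### The Hessian quartic, its node, and the projection involutions -/

/-- The Hessian quartic `∑ₐ 1/(λₐ yₐ) = 0` with denominators cleared. -/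
def hessian {k : Type*} [Field k] (lam : Fin 5 → k) : MvPolynomial (Fin 5) k :=
  ∑ a, ∏ b ∈ Finset.univ.erase a, MvPolynomial.C (lam b) * MvPolynomial.X b

/-- The parameters `(1, 1, 1, 1, 1/16)`. -/
def param (k : Type*) [Field k] : Fin 5 → k := ![1, 1, 1, 1, 1 / 16]

/-- The hyperplane `∑ yₐ = 0`; the ambient projective space of the Hessian surface `H` is the
projective space of its lines. -/
def hyperplane (k : Type*) [Field k] : Submodule k (Fin 5 → k) where
  carrier := {y | ∑ a, y a = 0}
  add_mem' := fun {x y} hx hy => by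
    simp only [Set.mem_ofPred_eq, Pi.add_apply, Finset.sum_add_distrib] at *
    rw [hx, hy, add_zero]
  zero_mem' := by simp
  smul_mem' := fun c x hx => by
    simp only [Set.mem_ofPred_eq, Pi.smul_apply, smul_eq_mul, ← Finset.mul_sum] at *
    rw [hx, mul_zero]

/-- The new node `(1 : 1 : 1 : 1 : -4)` of `H`. -/
def node (k : Type*) [Field k] : hyperplane k :=
  ⟨![1, 1, 1, 1, -4], by
    change ∑ a, (![1, 1, 1, 1, -4] : Fin 5 → k) a = 0
    simp [Fin.sum_univ_five]; norm_num⟩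

/-- The tangent space at the node of the ambient projective 3-space (up to a twist by the line of
the node); since the node is singular, it is also the Zariski tangent space of `H` there. -/
abbrev NodeTangent (k : Type*) [Field k] : Type _ :=
  hyperplane k ⧸ Submodule.span k {node k}

/-- The tangent vector represented by `v`. -/
abbrev tangent {k : Type*} [Field k] (v : hyperplane k) : NodeTangent k :=
  Submodule.Quotient.mk v

/-- The quadratic term of the Hessian quartic along the line `t ↦ x + t v` through the node `x`. -/
def coneForm {k : Type*} [Field k] (v : hyperplane k) : k :=
  (MvPolynomial.aeval (fun a => Polynomial.C ((node k : Fin 5 → k) a) +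
    Polynomial.X * Polynomial.C ((v : Fin 5 → k) a)) (hessian (param k))).coeff 2

/-- The curve `C`: the projectivized tangent cone of `H` at the node, that is, the exceptional
curve over the node in the minimal resolution `X` of `H`. The involution of `X` induced by
`y ↦ (1/(λₐ yₐ))ₐ` acts on the tangent space at the node as `-1`, so it fixes this curve pointwise,
and the curve maps isomorphically to the branch curve of the Coble surface which is the quotient
of `X` by this involution. -/
def conic (k : Type*) [Field k] : Set (ℙ k (NodeTangent k)) :=
  {p | ∃ (v : hyperplane k) (hv : tangent v ≠ 0),
    p = Projectivization.mk k (tangent v) hv ∧ coneForm v = 0}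

/-- The vertex `P_ab` of the pentahedron, with coordinates `1` and `-1` at `a` and `b` and `0`
elsewhere. -/
def vertex (R : Type*) [CommRing R] (a b : Fin 5) : Fin 5 → R := Pi.single a 1 - Pi.single b 1

/-- For a `k`-algebra `R` and an `R`-valued point `y` of the cone over `H`: `y'` is the image of `y`
under the involution attached to the projection of `H` from `P_ab`. That is, the line
`s ↦ y + s P_ab` meets `H`, away from `P_ab`, in a scheme of length two, namely in
its points at `s = 0` and at `s = r`, and `y' = y + r P_ab`. -/
def ProjInvolution {k R : Type*} [Field k] [CommRing R] [Algebra k R] (lam : Fin 5 → k)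
    (a b : Fin 5) (y y' : Fin 5 → R) : Prop :=
  ∃ c r : R, IsUnit c ∧ y' = y + r • vertex R a b ∧
    MvPolynomial.aeval (fun i => Polynomial.C (y i) + Polynomial.X * Polynomial.C (vertex R a b i))
        (hessian lam) =
      Polynomial.C c * Polynomial.X * (Polynomial.X - Polynomial.C r)

/-- The point `x + ε v` with values in the dual numbers, for the node `x`. -/
def nodePoint {k : Type*} [Field k] (v : hyperplane k) : Fin 5 → k[ε] := fun a =>
  TrivSqZeroExt.inl ((node k : Fin 5 → k) a) + TrivSqZeroExt.inr ((v : Fin 5 → k) a)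

/-- `g` is the permutation of the points of `C` given by the action of the projection involution
of `P_ab` on tangent directions at the node. -/
def IsInduced {k : Type*} [Field k] (a b : Fin 5) (g : Equiv.Perm (conic k)) : Prop :=
  ∀ (p : conic k) (v : hyperplane k) (hv : tangent v ≠ 0),
    (p : ℙ k (NodeTangent k)) = Projectivization.mk k (tangent v) hv →
    ∃ (v' : hyperplane k) (hv' : tangent v' ≠ 0),
      ProjInvolution (param k) a b (nodePoint v) (nodePoint v') ∧
      (g p : ℙ k (NodeTangent k)) = Projectivization.mk k (tangent v') hv'

/-- The group `Ḡ` of transformations of `C` generated by the ten `ḡ_ab`. -/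
def Gbar (k : Type*) [Field k] : Subgroup (Equiv.Perm (conic k)) :=
  Subgroup.closure {g | ∃ a b : Fin 5, a ≠ b ∧ IsInduced a b g}

/-- `φ` is an isomorphism from the projective line to the conic `C`: a bijection
given by quadratic forms. -/
def IsConicIso {k : Type*} [Field k] (φ : ℙ k (Fin 2 → k) ≃ conic k) : Prop :=
  ∃ q : QuadraticMap k (Fin 2 → k) (NodeTangent k), ∀ (u : Fin 2 → k) (hu : u ≠ 0),
    ∃ hq : q u ≠ 0, (φ (Projectivization.mk k u hu) : ℙ k (NodeTangent k)) =
      Projectivization.mk k (q u) hq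

/-- The Hurwitz integers `±i ± j ± k`. -/
def diagonals : Set Hurwitz :=
  {h | ∃ r s t : ℚ, (r = 1 ∨ r = -1) ∧ (s = 1 ∨ s = -1) ∧ (t = 1 ∨ t = -1) ∧
    (h : ℍ[ℚ]) = quat 0 r s t}

/-- The Hurwitz integers `±i ± j`, `±j ± k` and `±k ± i`. -/
def midpoints : Set Hurwitz :=
  {h | ∃ r s : ℚ, (r = 1 ∨ r = -1) ∧ (s = 1 ∨ s = -1) ∧
    ((h : ℍ[ℚ]) = quat 0 r s 0 ∨ (h : ℍ[ℚ]) = quat 0 0 r s ∨ (h : ℍ[ℚ]) = quat 0 s 0 r)}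

/-- The permutations of the projective line given by the images in `PGL₂(K)` of the elements of
a set `Q` of Hurwitz integers. -/
def quatPerms {K : Type*} [Field K] (ψ : K ⊗[ℤ] Hurwitz ≃ₐ[K] M₂ K) (Q : Set Hurwitz) :
    Set (Equiv.Perm (ℙ K (Fin 2 → K))) :=
  {τ | ∃ h ∈ Q, ∃ A : GL (Fin 2) K, (A : M₂ K) = ψ (1 ⊗ₜ h) ∧ τ = glPerm K A}

end CobleHessian

end

open CobleHessian

/-!
The tangent space of the ambient projective space at the node `x` carries coordinates in which the
four vertices `P_a4` are the diagonals `n_a = (±1, ±1, ±1)` of a cube, up to scalars, and the `P_ab`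
with `a, b ≠ 4` are the differences `n_a - n_b`. In these coordinates the tangent cone is
`x · x = 0` (`coneForm_eq_zero_iff`). The Hessian is quadratic along a line through `P_ab`, and
working over the dual numbers one finds that the differential at `x` of the projection involution is
the orthogonal reflection in the direction of `P_ab` (`realizes_four`, `realizes_of_ne`). On the
imaginary quaternions the reflection in the direction of `h` is `w ↦ -h w h⁻¹`.

An isomorphism `ψ` of the quaternions with `M₂` turns isotropic vectors into nilpotent matrices, and
these are `u ↦ u · (u₁, -u₀)` up to scalars. So the conic is a projective line
(`isConicIso_conicEquiv`), and conjugation by `h` becomes the action of `ψ(h)` on it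
(`isInduced_iff`). This proves that the induced transformations are well defined and are the images
of `±i ± j ± k` and of `±i ± j`, `±j ± k`, `±k ± i`. The conjugations by these quaternions preserve
`ℋ ⊗ ℤ[1/3]` (`exists_conj`), so the group they generate is a subgroup of `F(ℤ[1/3])`.

Everything else is reduction theory of the rotation group over `ℚ₃`, of which `F(ℤ[1/3])` is a
subgroup through its action on the imaginary quaternions.

* Descent: if a rotation matrix has denominators divisible by `3`, then modulo `3` some column,
  cleared of denominators, is a diagonal of the cube, and the rotation by `π` about that diagonal
  lowers the denominators (`exists_descent`).
* The rotations of the cube, generated by the conjugations by `±i ± j`, `±j ± k`, `±k ± i`, map onto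
  `SO₃(𝔽₃)`. Hence the group `Δ` generated by all these conjugations, times the congruence subgroup
  modulo `3`, is the whole rotation group over `ℚ₃` (`exists_congr_one`).
* An element of `F(ℤ[1/3])` in the congruence subgroup is an orthogonal matrix with integer entries
  which is `1` modulo `3`, so it is `1` (`eq_one_of_congr_one`). Hence `Δ` is all of `F(ℤ[1/3])`
  (`conjSubgroup_eq_top`), and its image in `PGL₂(ℚ₃)` is discrete.
* A discrete subgroup of `PGL₂(ℚ₃)` meets the congruence subgroup trivially, since repeated
  cubing contracts the latter to `1` and never maps an element other than `1` to `1`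
  (`eq_one_of_discrete`). So a discrete subgroup
  containing the image of `F(ℤ[1/3])` is equal to it (`maximal_range_toPGL`).
-/

noncomputable section

namespace CobleHessian

/-! ### Scalar extensions of the Hurwitz order as quaternion algebras -/

/-- The quaternion `a + b i + c j + d k`. -/
def quatOf {K : Type*} [CommRing K] (a b c d : K) : ℍ[K] := ⟨a, b, c, d⟩

section ofNat
variable {K : Type*} [CommRing K] (n : ℕ) [n.AtLeastTwo]

@[simp] theorem re_ofNat : (ofNat(n) : ℍ[K]).re = ofNat(n) := rfl
@[simp] theorem imI_ofNat : (ofNat(n) : ℍ[K]).imI = 0 := rfl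
@[simp] theorem imJ_ofNat : (ofNat(n) : ℍ[K]).imJ = 0 := rfl
@[simp] theorem imK_ofNat : (ofNat(n) : ℍ[K]).imK = 0 := rfl

end ofNat

section quatOf
variable {K : Type*} [CommRing K] (a b c d : K)

@[simp] theorem quatOf_re : (quatOf a b c d).re = a := rfl
@[simp] theorem quatOf_imI : (quatOf a b c d).imI = b := rfl
@[simp] theorem quatOf_imJ : (quatOf a b c d).imJ = c := rfl
@[simp] theorem quatOf_imK : (quatOf a b c d).imK = d := rfl

end quatOf

/-- The inclusion of the rational quaternions into the quaternions over a field of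
characteristic zero. -/
def quatCast (K : Type*) [Field K] [CharZero K] : ℍ[ℚ] →+* ℍ[K] where
  toFun q := quatOf q.re q.imI q.imJ q.imK
  map_one' := by ext <;> simp
  map_mul' x y := by ext <;> simp
  map_zero' := by ext <;> simp
  map_add' x y := by ext <;> simp

section quatCast
variable {K : Type*} [Field K] [CharZero K]

@[simp] theorem quatCast_re (q : ℍ[ℚ]) : (quatCast K q).re = q.re := rfl
@[simp] theorem quatCast_imI (q : ℍ[ℚ]) : (quatCast K q).imI = q.imI := rfl
@[simp] theorem quatCast_imJ (q : ℍ[ℚ]) : (quatCast K q).imJ = q.imJ := rfl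
@[simp] theorem quatCast_imK (q : ℍ[ℚ]) : (quatCast K q).imK = q.imK := rfl

end quatCast

/-- The Hurwitz integer with coordinates `a + e/2, b + e/2, c + e/2, d + e/2`. -/
def hur (a b c d e : ℤ) : Hurwitz :=
  ⟨quat (a + e / 2) (b + e / 2) (c + e / 2) (d + e / 2),
    mem_span_hurwitzUnits.2 ⟨a, b, c, d, e, rfl⟩⟩

theorem exists_eq_hur (h : Hurwitz) : ∃ a b c d e, h = hur a b c d e := by
  obtain ⟨a, b, c, d, e, H⟩ := mem_span_hurwitzUnits.1 h.2
  exact ⟨a, b, c, d, e, Subtype.ext H⟩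

/-- The `K`-algebra homomorphism `K ⊗ ℋ → ℍ[K]`, `s ⊗ h ↦ s h`. -/
def hurwitzHom (K : Type*) [Field K] [CharZero K] : K ⊗[ℤ] Hurwitz →ₐ[K] ℍ[K] :=
  Algebra.TensorProduct.lift (Algebra.ofId K _)
    ((quatCast K).comp Hurwitz.subtype).toIntAlgHom (fun s _ => Algebra.commutes s _)

section hurwitzHom
variable {K : Type*} [Field K] [CharZero K]

theorem hurwitzHom_tmul (s : K) (h : Hurwitz) :
    hurwitzHom K (s ⊗ₜ h) = s • quatCast K h := by
  rw [Algebra.smul_def]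
  rfl

/-- Where `2` is invertible, `ℋ` and the order spanned by `1, i, j, k` have the same scalar
extension. -/
theorem exists_eq_sum_tmul (x : K ⊗[ℤ] Hurwitz) : ∃ a b c d : K,
    x = a ⊗ₜ hur 1 0 0 0 0 + b ⊗ₜ hur 0 1 0 0 0 + c ⊗ₜ hur 0 0 1 0 0 + d ⊗ₜ hur 0 0 0 1 0 := by
  induction x using TensorProduct.induction_on with
  | zero => exact ⟨0, 0, 0, 0, by simp⟩
  | add x y hx hy =>
    obtain ⟨a, b, c, d, rfl⟩ := hx
    obtain ⟨a', b', c', d', rfl⟩ := hy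
    exact ⟨a + a', b + b', c + c', d + d', by simp only [TensorProduct.add_tmul]; abel⟩
  | tmul s h =>
    obtain ⟨a, b, c, d, e, rfl⟩ := exists_eq_hur h
    have key : (2 : ℤ) • hur a b c d e = (2 * a + e) • hur 1 0 0 0 0 +
        (2 * b + e) • hur 0 1 0 0 0 + (2 * c + e) • hur 0 0 1 0 0 +
        (2 * d + e) • hur 0 0 0 1 0 := by
      rw [two_zsmul]
      apply Subtype.ext
      simp only [Subring.coe_add, AddSubgroupClass.coe_zsmul]
      ext <;> simp [hur] <;> ring
    refine ⟨(2 * a + e : ℤ) • (s / 2), (2 * b + e : ℤ) • (s / 2), (2 * c + e : ℤ) • (s / 2),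
      (2 * d + e : ℤ) • (s / 2), ?_⟩
    have h2 : s = (2 : ℤ) • (s / 2) := by
      rw [zsmul_eq_mul]; push_cast; field_simp
    conv_lhs => rw [h2, TensorProduct.smul_tmul, key]
    simp only [TensorProduct.tmul_add, TensorProduct.smul_tmul]

theorem hurwitzHom_sum (a b c d : K) :
    hurwitzHom K (a ⊗ₜ hur 1 0 0 0 0 + b ⊗ₜ hur 0 1 0 0 0 + c ⊗ₜ hur 0 0 1 0 0 +
      d ⊗ₜ hur 0 0 0 1 0) = quatOf a b c d := by
  simp only [map_add, hurwitzHom_tmul]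
  ext <;> simp [hur]

theorem hurwitzHom_bijective : Function.Bijective (hurwitzHom K) := by
  constructor
  · rw [injective_iff_map_eq_zero]
    intro x hx
    obtain ⟨a, b, c, d, rfl⟩ := exists_eq_sum_tmul x
    rw [hurwitzHom_sum] at hx
    have h0 := congrArg (fun q : ℍ[K] => q.re) hx
    have h1 := congrArg (fun q : ℍ[K] => q.imI) hx
    have h2 := congrArg (fun q : ℍ[K] => q.imJ) hx
    have h3 := congrArg (fun q : ℍ[K] => q.imK) hx
    simp at h0 h1 h2 h3
    simp [h0, h1, h2, h3]
  · intro q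
    exact ⟨_, (hurwitzHom_sum q.re q.imI q.imJ q.imK).trans (by ext <;> simp)⟩

end hurwitzHom

/-- The isomorphism `K ⊗ ℋ ≅ ℍ[K]`. -/
def hurwitzEquiv (K : Type*) [Field K] [CharZero K] : K ⊗[ℤ] Hurwitz ≃ₐ[K] ℍ[K] :=
  AlgEquiv.ofBijective (hurwitzHom K) hurwitzHom_bijective

theorem hurwitzEquiv_one_tmul {K : Type*} [Field K] [CharZero K] (h : Hurwitz) :
    hurwitzEquiv K (1 ⊗ₜ h) = quatCast K h := by
  rw [hurwitzEquiv, AlgEquiv.ofBijective_apply]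
  rw [hurwitzHom_tmul, one_smul]

/-! ### The homomorphism from the automorphisms over `ℤ[1/3]` to the automorphisms over a field -/

theorem ZThird.exists_eq (x : ZThird) : ∃ (n : ℕ) (z : ℤ), x * 3 ^ n = (z : ZThird) := by
  obtain ⟨n, z, h⟩ := IsLocalization.Away.surj (3 : ℤ) x
  exact ⟨n, z, by simpa using h⟩

theorem ZThird.isUnit_three : IsUnit (3 : ZThird) := by
  simpa using IsLocalization.Away.algebraMap_isUnit (S := ZThird) (3 : ℤ)

theorem ZThird.toField_injective (K : Type*) [Field K] [CharZero K] :
    Function.Injective (ZThird.toField K) := by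
  rw [injective_iff_map_eq_zero]
  intro x hx
  obtain ⟨n, z, h⟩ := ZThird.exists_eq x
  have h1 := congrArg (ZThird.toField K) h
  rw [map_mul, hx, zero_mul, map_intCast, eq_comm, Int.cast_eq_zero] at h1
  rw [h1, Int.cast_zero] at h
  exact ((ZThird.isUnit_three.pow n).mul_left_eq_zero).1 h

instance : Module.IsTorsionFree ℤ Hurwitz := by
  refine Module.isTorsionFree_iff_smul_eq_zero.2 fun n x h => ?_
  by_cases hn : n = 0
  · exact Or.inl hn
  right
  have h1 : n • (x : ℍ[ℚ]) = 0 := congrArg Subtype.val h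
  apply Subtype.ext
  rw [← Int.cast_smul_eq_zsmul ℚ] at h1
  exact (smul_eq_zero.1 h1).resolve_left (by exact_mod_cast hn)

theorem extend_injective {R S : Type*} [CommRing R] [CommRing S] {f : R →+* S}
    (hf : Function.Injective f) : Function.Injective (extend f) :=
  Module.Flat.rTensor_preserves_injective_linearMap (M := Hurwitz)
    f.toIntAlgHom.toLinearMap hf

theorem extend_apply {R S : Type*} [CommRing R] [CommRing S] (f : R →+* S) (σ : F R)
    (x : R ⊗[ℤ] Hurwitz) : extend f (σ x) = F.map f σ (extend f x) :=
  (baseChange_extend f (σ : _ →ₐ[R] _) x).symm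

theorem F.map_injective {R S : Type*} [CommRing R] [CommRing S] {f : R →+* S}
    (hf : Function.Injective f) : Function.Injective (F.map f) := by
  intro σ τ h
  apply AlgEquiv.ext
  intro x
  apply extend_injective hf
  rw [extend_apply, extend_apply, h]

theorem toPGL_apply {K : Type*} [Field K] [CharZero K] (ψ : K ⊗[ℤ] Hurwitz ≃ₐ[K] M₂ K)
    (σ : F ZThird) : toPGL ψ σ = FEquivPGL ψ (F.map (ZThird.toField K) σ) := rfl

theorem toPGL_injective {K : Type*} [Field K] [CharZero K] (ψ : K ⊗[ℤ] Hurwitz ≃ₐ[K] M₂ K) :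
    Function.Injective (toPGL ψ) := by
  intro σ τ h
  rw [toPGL_apply, toPGL_apply] at h
  exact F.map_injective (ZThird.toField_injective K) ((FEquivPGL ψ).injective h)

/-! ### Conjugation by the quaternions `±i ± j ± k` and `±i ± j`, `±j ± k`, `±k ± i` -/

/-- An element `h` with `r h² = 1` for a scalar `r` is invertible; this is the conjugation by it. -/
def conjHom {R A : Type*} [CommRing R] [Ring A] [Algebra R A] (r : R) (h : A)
    (hr : r • (h * h) = 1) : A →ₐ[R] A where
  toFun x := r • (h * x * h)
  map_one' := by simpa using hr
  map_mul' x y := by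
    have : r • (h * x * h) * r • (h * y * h) = r • (h * x * (r • (h * h)) * y * h) := by
      simp only [smul_mul_assoc, mul_smul_comm, mul_assoc]
    rw [this, hr, mul_one, mul_assoc h x y]
  map_zero' := by simp
  map_add' x y := by rw [mul_add, add_mul, smul_add]
  commutes' s := by
    rw [← Algebra.commutes, mul_assoc, ← mul_smul_comm, hr, mul_one]

section conjHom
variable {R A : Type*} [CommRing R] [Ring A] [Algebra R A] {r : R} {h : A}
  (hr : r • (h * h) = 1)

theorem conjHom_mul (x : A) : conjHom r h hr x * h = h * x := by
  change r • (h * x * h) * h = _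
  rw [smul_mul_assoc, mul_assoc (h * x), ← mul_smul_comm, hr, mul_one]

theorem conjHom_conjHom (x : A) : conjHom r h hr (conjHom r h hr x) = x := by
  change r • (h * (r • (h * x * h)) * h) = x
  calc r • (h * (r • (h * x * h)) * h) = (r • (h * h)) * x * (r • (h * h)) := by
        simp only [smul_mul_assoc, mul_smul_comm, mul_assoc]
    _ = x := by rw [hr, one_mul, mul_one]

end conjHom

/-- `c` is the conjugation `x ↦ h x h⁻¹`. -/
def ConjugatesBy {R : Type*} [CommRing R] (c : F R) (h : Hurwitz) : Prop :=
  ∀ x, c x * ((1 : R) ⊗ₜ[ℤ] h) = ((1 : R) ⊗ₜ[ℤ] h) * x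

/-- The elements of `F(R)` which are conjugations by one of the quaternions `±i ± j ± k`,
`±i ± j`, `±j ± k`, `±k ± i`. -/
def hurwitzConjugations (R : Type*) [CommRing R] : Set (F R) :=
  {c | ∃ h ∈ diagonals ∪ midpoints, ConjugatesBy c h}

theorem diagonals_mul_self {h : Hurwitz} (hh : h ∈ diagonals) : h * h = -3 := by
  obtain ⟨r, s, t, hr, hs, ht, H⟩ := hh
  have hr2 : r * r = 1 := by rcases hr with rfl | rfl <;> norm_num
  have hs2 : s * s = 1 := by rcases hs with rfl | rfl <;> norm_num
  have ht2 : t * t = 1 := by rcases ht with rfl | rfl <;> norm_num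
  apply Subtype.ext
  have h3 : (-3 : Hurwitz) = -(1 + 1 + 1) := by norm_num
  rw [Subring.coe_mul, H, h3]
  ext <;> simp <;> linarith

theorem midpoints_mul_self {h : Hurwitz} (hh : h ∈ midpoints) : h * h = -2 := by
  obtain ⟨r, s, hr, hs, H⟩ := hh
  have hr2 : r * r = 1 := by rcases hr with rfl | rfl <;> norm_num
  have hs2 : s * s = 1 := by rcases hs with rfl | rfl <;> norm_num
  apply Subtype.ext
  have h3 : (-2 : Hurwitz) = -(1 + 1) := by norm_num
  rw [Subring.coe_mul, h3]
  rcases H with H | H | H <;> rw [H] <;> ext <;> simp <;> linarith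

theorem exists_conj_diagonals {R : Type*} [CommRing R] (h3 : IsUnit (3 : R)) {h : Hurwitz}
    (hh : h ∈ diagonals) :
    ∃ c : F R, ConjugatesBy c h := by
  obtain ⟨u, hu⟩ := h3.exists_left_inv
  have hr : (-u) • (((1 : R) ⊗ₜ[ℤ] h) * (1 ⊗ₜ h)) = 1 := by
    have e1 : ((1 : R) ⊗ₜ[ℤ] (-3 : Hurwitz)) = (-3 : R) ⊗ₜ[ℤ] (1 : Hurwitz) := by
      have : (-3 : Hurwitz) = (-3 : ℤ) • 1 := by rw [zsmul_eq_mul]; push_cast; simp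
      rw [this, ← TensorProduct.smul_tmul, zsmul_eq_mul]; push_cast; simp
    rw [Algebra.TensorProduct.tmul_mul_tmul, diagonals_mul_self hh, mul_one, e1,
      TensorProduct.smul_tmul', smul_eq_mul, neg_mul_neg, hu]
    rfl
  exact ⟨AlgEquiv.ofAlgHom (conjHom _ _ hr) (conjHom _ _ hr)
    (AlgHom.ext (conjHom_conjHom hr)) (AlgHom.ext (conjHom_conjHom hr)), conjHom_mul hr⟩

/-- The quaternions `±i ± j`, `±j ± k`, `±k ± i` have norm `2` and yet normalize `ℋ`. -/
theorem exists_conj_midpoints {R : Type*} [CommRing R] {h : Hurwitz} (hh : h ∈ midpoints) :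
    ∃ c : F R, ConjugatesBy c h := by
  have hr : (-1 / 2 : ℚ) • ((h : ℍ[ℚ]) * (h : ℍ[ℚ])) = 1 := by
    have h2 : (-2 : Hurwitz) = -(1 + 1) := by norm_num
    rw [← Subring.coe_mul, midpoints_mul_self hh, h2]
    ext <;> simp; norm_num
  have hmem : ∀ x : Hurwitz, conjHom _ _ hr (x : ℍ[ℚ]) ∈ Hurwitz := by
    intro x
    obtain ⟨r, s, hr', hs', H⟩ := hh
    obtain ⟨a, b, c, d, e, hx⟩ := mem_span_hurwitzUnits.1 x.2
    apply mem_span_hurwitzUnits.2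
    change ∃ _ _ _ _ _ : ℤ, (-1 / 2 : ℚ) • ((h : ℍ[ℚ]) * x * (h : ℍ[ℚ])) = _
    rw [hx]
    rcases H with H | H | H <;> rw [H] <;> rcases hr' with rfl | rfl <;>
      rcases hs' with rfl | rfl
    · refine ⟨a, c, b, -d - e, e, ?_⟩; ext <;> simp <;> ring
    · refine ⟨a, -c - e, -b - e, -d - e, e, ?_⟩; ext <;> simp <;> ring
    · refine ⟨a, -c - e, -b - e, -d - e, e, ?_⟩; ext <;> simp <;> ring
    · refine ⟨a, c, b, -d - e, e, ?_⟩; ext <;> simp <;> ring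
    · refine ⟨a, -b - e, d, c, e, ?_⟩; ext <;> simp <;> ring
    · refine ⟨a, -b - e, -d - e, -c - e, e, ?_⟩; ext <;> simp <;> ring
    · refine ⟨a, -b - e, -d - e, -c - e, e, ?_⟩; ext <;> simp <;> ring
    · refine ⟨a, -b - e, d, c, e, ?_⟩; ext <;> simp <;> ring
    · refine ⟨a, d, -c - e, b, e, ?_⟩; ext <;> simp <;> ring
    · refine ⟨a, -d - e, -c - e, -b - e, e, ?_⟩; ext <;> simp <;> ring
    · refine ⟨a, -d - e, -c - e, -b - e, e, ?_⟩; ext <;> simp <;> ring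
    · refine ⟨a, d, -c - e, b, e, ?_⟩; ext <;> simp <;> ring
  let s : Hurwitz →ₐ[ℤ] Hurwitz := RingHom.toIntAlgHom
    (((conjHom _ _ hr : ℍ[ℚ] →ₐ[ℚ] ℍ[ℚ]) : ℍ[ℚ] →+* ℍ[ℚ]).restrict Hurwitz Hurwitz
      (fun x hx => hmem ⟨x, hx⟩))
  have hs : ∀ x, s x * h = h * x := fun x => Subtype.ext (conjHom_mul hr (x : ℍ[ℚ]))
  have hss : ∀ x, s (s x) = x := fun x => Subtype.ext (conjHom_conjHom hr (x : ℍ[ℚ]))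
  let t : R ⊗[ℤ] Hurwitz →ₐ[R] R ⊗[ℤ] Hurwitz :=
    Algebra.TensorProduct.map (AlgHom.id R R) s
  have ht : t.comp t = AlgHom.id _ _ := by
    ext x
    simp [t, hss]
  refine ⟨AlgEquiv.ofAlgHom t t ht ht, fun x => ?_⟩
  change t x * _ = _
  induction x using TensorProduct.induction_on with
  | zero => simp
  | add x y hx hy => rw [map_add, add_mul, mul_add, hx, hy]
  | tmul r x => simp [t, hs]

theorem exists_conj {R : Type*} [CommRing R] (h3 : IsUnit (3 : R)) {h : Hurwitz}
    (hh : h ∈ diagonals ∪ midpoints) :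
    ∃ c : F R, ConjugatesBy c h :=
  hh.elim (exists_conj_diagonals h3) exists_conj_midpoints

/-! ### Automorphisms of a quaternion algebra as orthogonal matrices -/

section Rotation
variable {K : Type*} [Field K]

/-- The coordinates of the imaginary part of a quaternion. -/
def imVec : ℍ[K] →ₗ[K] (Fin 3 → K) where
  toFun q := ![q.imI, q.imJ, q.imK]
  map_add' x y := by ext a; fin_cases a <;> rfl
  map_smul' c x := by ext a; fin_cases a <;> rfl

/-- The purely imaginary quaternion with given coordinates. -/
def ofVec : (Fin 3 → K) →ₗ[K] ℍ[K] where
  toFun v := quatOf 0 (v 0) (v 1) (v 2)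
  map_add' x y := by ext <;> simp
  map_smul' c x := by ext <;> simp

@[simp] theorem ofVec_re (v : Fin 3 → K) : (ofVec v).re = 0 := rfl
@[simp] theorem ofVec_imI (v : Fin 3 → K) : (ofVec v).imI = v 0 := rfl
@[simp] theorem ofVec_imJ (v : Fin 3 → K) : (ofVec v).imJ = v 1 := rfl
@[simp] theorem ofVec_imK (v : Fin 3 → K) : (ofVec v).imK = v 2 := rfl

@[simp] theorem imVec_zero (q : ℍ[K]) : imVec q 0 = q.imI := rfl
@[simp] theorem imVec_one (q : ℍ[K]) : imVec q 1 = q.imJ := rfl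
@[simp] theorem imVec_two (q : ℍ[K]) : imVec q 2 = q.imK := rfl

@[simp] theorem imVec_ofVec (v : Fin 3 → K) : imVec (ofVec v) = v := by
  ext a; fin_cases a <;> rfl

theorem ofVec_imVec {q : ℍ[K]} (hq : q.re = 0) : ofVec (imVec q) = q := by
  ext <;> simp [hq]

theorem eq_coe_add_ofVec (q : ℍ[K]) : q = algebraMap K ℍ[K] q.re + ofVec (imVec q) := by
  ext <;> simp

theorem re_mul_comm (x y : ℍ[K]) : (x * y).re = (y * x).re := by
  simp; ring

theorem re_ofVec_mul_ofVec (v w : Fin 3 → K) : (ofVec v * ofVec w).re = -(v ⬝ᵥ w) := by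
  simp [dotProduct, Fin.sum_univ_three]; ring

/-- Automorphisms preserve the real part: `i, j, k` are commutators up to a scalar. -/
theorem re_map [CharZero K] (σ : ℍ[K] ≃ₐ[K] ℍ[K]) (q : ℍ[K]) : (σ q).re = q.re := by
  have key : ∀ x y : ℍ[K], y * x = -(x * y) → (σ (x * y)).re = 0 := by
    intro x y h
    have h1 : (σ (x * y)).re = (σ (y * x)).re := by
      rw [map_mul, map_mul, re_mul_comm]
    rw [h, map_neg, Quaternion.re_neg] at h1
    linear_combination h1 / 2
  have hi : (σ (ofVec ![1, 0, 0])).re = 0 := by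
    have : (ofVec ![1, 0, 0] : ℍ[K]) = ofVec ![0, 1, 0] * ofVec ![0, 0, 1] := by
      ext <;> simp
    rw [this]
    exact key _ _ (by ext <;> simp)
  have hj : (σ (ofVec ![0, 1, 0])).re = 0 := by
    have : (ofVec ![0, 1, 0] : ℍ[K]) = ofVec ![0, 0, 1] * ofVec ![1, 0, 0] := by
      ext <;> simp
    rw [this]
    exact key _ _ (by ext <;> simp)
  have hk : (σ (ofVec ![0, 0, 1])).re = 0 := by
    have : (ofVec ![0, 0, 1] : ℍ[K]) = ofVec ![1, 0, 0] * ofVec ![0, 1, 0] := by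
      ext <;> simp
    rw [this]
    exact key _ _ (by ext <;> simp)
  have hq : q = algebraMap K ℍ[K] q.re + (q.imI • ofVec ![1, 0, 0] + q.imJ • ofVec ![0, 1, 0] +
      q.imK • ofVec ![0, 0, 1]) := by
    ext <;> simp
  rw [hq]
  simp only [map_add, map_smul, AlgEquiv.commutes, Quaternion.re_add, Quaternion.re_smul, hi, hj,
    hk]
  simp

/-- The matrix of an automorphism of `ℍ[K]` acting on the imaginary quaternions. -/
def rot [CharZero K] : (ℍ[K] ≃ₐ[K] ℍ[K]) →* Matrix (Fin 3) (Fin 3) K where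
  toFun σ := LinearMap.toMatrix' (imVec ∘ₗ σ.toLinearMap ∘ₗ ofVec)
  map_one' := by
    rw [← LinearMap.toMatrix'_id]
    congr 1
    exact LinearMap.ext imVec_ofVec
  map_mul' σ τ := by
    rw [← LinearMap.toMatrix'_comp]
    congr 1
    apply LinearMap.ext
    intro v
    simp only [LinearMap.comp_apply, AlgEquiv.toLinearMap_apply, AlgEquiv.mul_apply]
    rw [ofVec_imVec (by rw [re_map, ofVec_re])]

section CharZero
variable [CharZero K]

theorem rot_mulVec (σ : ℍ[K] ≃ₐ[K] ℍ[K]) (v : Fin 3 → K) :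
    (rot σ).mulVec v = imVec (σ (ofVec v)) :=
  LinearMap.toMatrix'_mulVec (imVec ∘ₗ σ.toLinearMap ∘ₗ ofVec) v

theorem map_ofVec (σ : ℍ[K] ≃ₐ[K] ℍ[K]) (v : Fin 3 → K) :
    σ (ofVec v) = ofVec ((rot σ).mulVec v) := by
  rw [rot_mulVec, ofVec_imVec (by rw [re_map, ofVec_re])]

theorem rot_apply (σ : ℍ[K] ≃ₐ[K] ℍ[K]) (a b : Fin 3) :
    rot σ a b = imVec (σ (ofVec (Pi.single b 1))) a := by
  rw [← rot_mulVec, Matrix.mulVec_single_one]; rfl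

/-- Algebra automorphisms fix the scalars, so they are determined by their action on the imaginary
quaternions. -/
theorem rot_injective : Function.Injective (rot : (ℍ[K] ≃ₐ[K] ℍ[K]) →* _) := by
  intro σ τ h
  apply AlgEquiv.ext
  intro q
  rw [eq_coe_add_ofVec q, map_add, map_add, map_ofVec, map_ofVec, h, AlgEquiv.commutes,
    AlgEquiv.commutes]

theorem rot_dotProduct (σ : ℍ[K] ≃ₐ[K] ℍ[K]) (v w : Fin 3 → K) :
    (rot σ).mulVec v ⬝ᵥ (rot σ).mulVec w = v ⬝ᵥ w := by
  have h := re_map σ (ofVec v * ofVec w)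
  rw [map_mul, map_ofVec, map_ofVec, re_ofVec_mul_ofVec, re_ofVec_mul_ofVec] at h
  exact neg_injective h

theorem rot_orthogonal (σ : ℍ[K] ≃ₐ[K] ℍ[K]) (b c : Fin 3) :
    ∑ a, rot σ a b * rot σ a c = if b = c then 1 else 0 := by
  have h := rot_dotProduct σ (Pi.single b 1) (Pi.single c 1)
  rw [Matrix.mulVec_single_one, Matrix.mulVec_single_one] at h
  simpa [dotProduct, Pi.single_apply, eq_comm] using h

/-- The third column is the cross product of the first two. -/
theorem rot_cross (σ : ℍ[K] ≃ₐ[K] ℍ[K]) :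
    rot σ 0 2 = rot σ 1 0 * rot σ 2 1 - rot σ 2 0 * rot σ 1 1 ∧
    rot σ 1 2 = rot σ 2 0 * rot σ 0 1 - rot σ 0 0 * rot σ 2 1 ∧
    rot σ 2 2 = rot σ 0 0 * rot σ 1 1 - rot σ 1 0 * rot σ 0 1 := by
  have h : (ofVec (Pi.single 2 1) : ℍ[K]) = ofVec (Pi.single 0 1) * ofVec (Pi.single 1 1) := by
    ext <;> simp
  have h2 := congrArg σ h
  rw [map_mul, map_ofVec, map_ofVec, map_ofVec] at h2
  simp only [Matrix.mulVec_single_one] at h2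
  refine ⟨?_, ?_, ?_⟩
  · simpa using congrArg (fun q : ℍ[K] => q.imI) h2
  · have := congrArg (fun q : ℍ[K] => q.imJ) h2
    simp at this
    rw [this]; ring
  · simpa using congrArg (fun q : ℍ[K] => q.imK) h2

/-- Conjugation by an imaginary quaternion `n` is the rotation by `π` about the axis `n`. -/
theorem rot_conj (σ : ℍ[K] ≃ₐ[K] ℍ[K]) (n : Fin 3 → K)
    (hσ : ∀ x, σ x * ofVec n = ofVec n * x) (v : Fin 3 → K) (a : Fin 3) :
    (n ⬝ᵥ n) * (rot σ).mulVec v a = 2 * (n ⬝ᵥ v) * n a - (n ⬝ᵥ n) * v a := by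
  have h1 : ofVec n * ofVec n = algebraMap K ℍ[K] (-(n ⬝ᵥ n)) := by
    ext <;> simp [dotProduct, Fin.sum_univ_three] <;> ring
  have h2 : (n ⬝ᵥ n) • σ (ofVec v) = -(ofVec n * ofVec v * ofVec n) := by
    rw [← hσ, mul_assoc, h1, ← Algebra.commutes, ← Algebra.smul_def, neg_smul, neg_neg]
  have h3 := congrArg (fun q => imVec q a) h2
  simp only [map_smul, Pi.smul_apply, smul_eq_mul, ← rot_mulVec] at h3
  rw [h3]
  fin_cases a <;> simp [dotProduct, Fin.sum_univ_three] <;> ring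

end CharZero

end Rotation

/-! ### Reduction theory of the rotation group over the `3`-adic integers -/

theorem toZMod_eq_zero_iff (x : ℤ_[3]) : PadicInt.toZMod x = 0 ↔ (3 : ℤ_[3]) ∣ x := by
  rw [← RingHom.mem_ker, PadicInt.ker_toZMod, PadicInt.maximalIdeal_eq_span_p,
    Ideal.mem_span_singleton]
  norm_cast

theorem sum_sq_mod_three : ∀ x y z : ZMod 3, x ^ 2 + y ^ 2 + z ^ 2 = 0 →
    (x ≠ 0 ∨ y ≠ 0 ∨ z ≠ 0) →
    x ^ 2 = 1 ∧ y ^ 2 = 1 ∧ z ^ 2 = 1 := by decide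

theorem eq_of_sum_mod_three : ∀ x y z : ZMod 3, x + y + z = 0 → x ^ 2 + y ^ 2 + z ^ 2 = 0 →
    y = x ∧ z = x := by decide

/-- If the vector `u ≡ (1, 1, 1)` modulo `3` and the vector `w` are isotropic and orthogonal modulo
`9`, then the rotation by `π` about `(1, 1, 1)` maps `w` to a multiple of `3`. -/
theorem nine_dvd_of_orthogonal {u w : Fin 3 → ℤ_[3]} (hu : ∀ i, (3 : ℤ_[3]) ∣ u i - 1)
    (huu : (9 : ℤ_[3]) ∣ ∑ i, u i ^ 2) (huw : (9 : ℤ_[3]) ∣ ∑ i, u i * w i)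
    (hww : (9 : ℤ_[3]) ∣ ∑ i, w i ^ 2) (a : Fin 3) : (9 : ℤ_[3]) ∣ 2 * ∑ i, w i - 3 * w a := by
  have three : ∀ x : ℤ_[3], (9 : ℤ_[3]) ∣ 3 * x → (3 : ℤ_[3]) ∣ x := by
    rintro x ⟨y, hy⟩
    exact ⟨y, mul_left_cancel₀ (by norm_num : (3 : ℤ_[3]) ≠ 0) (by rw [hy]; ring)⟩
  choose t ht using hu
  have ht' : ∀ i, u i = 1 + 3 * t i := fun i => by linear_combination ht i
  simp only [Fin.sum_univ_three, ht'] at huu huw hww ⊢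
  have h1 : (3 : ℤ_[3]) ∣ 1 + 2 * (t 0 + t 1 + t 2) := by
    apply three
    obtain ⟨y, hy⟩ := huu
    exact ⟨y - (t 0 ^ 2 + t 1 ^ 2 + t 2 ^ 2), by linear_combination hy⟩
  have h2 : (3 : ℤ_[3]) ∣ w 0 + w 1 + w 2 := by
    obtain ⟨y, hy⟩ := huw
    exact ⟨3 * y - (t 0 * w 0 + t 1 * w 1 + t 2 * w 2), by linear_combination hy⟩
  have h3 : (3 : ℤ_[3]) ∣ w 0 ^ 2 + w 1 ^ 2 + w 2 ^ 2 := by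
    obtain ⟨y, hy⟩ := hww
    exact ⟨3 * y, by linear_combination hy⟩
  obtain ⟨e1, e2⟩ := eq_of_sum_mod_three (PadicInt.toZMod (w 0)) (PadicInt.toZMod (w 1))
    (PadicInt.toZMod (w 2)) (by simpa using (toZMod_eq_zero_iff _).2 h2)
    (by simpa using (toZMod_eq_zero_iff _).2 h3)
  obtain ⟨s, hs⟩ : (3 : ℤ_[3]) ∣ w 1 - w 0 := (toZMod_eq_zero_iff _).1 (by simp [e1])
  obtain ⟨r, hr⟩ : (3 : ℤ_[3]) ∣ w 2 - w 0 := (toZMod_eq_zero_iff _).1 (by simp [e2])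
  have h4 : (3 : ℤ_[3]) ∣ w 0 + s + r + w 0 * (t 0 + t 1 + t 2) := by
    apply three
    obtain ⟨y, hy⟩ := huw
    exact ⟨y - (t 1 * s + t 2 * r), by
      linear_combination hy - (1 + 3 * t 1) * hs - (1 + 3 * t 2) * hr⟩
  have h5 : (3 : ℤ_[3]) ∣ w 0 + 2 * (s + r) := by
    obtain ⟨y, hy⟩ := h4
    obtain ⟨z, hz⟩ := h1
    exact ⟨2 * y - w 0 * z, by linear_combination 2 * hy - w 0 * hz⟩
  have h6 : (9 : ℤ_[3]) ∣ 2 * (w 0 + w 1 + w 2) - 3 * w 0 := by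
    obtain ⟨y, hy⟩ := h5
    exact ⟨y, by linear_combination 3 * hy + 2 * hs + 2 * hr⟩
  obtain ⟨y, hy⟩ := h6
  fin_cases a
  · exact ⟨y, hy⟩
  · exact ⟨y - s, by simp; linear_combination hy - 3 * hs⟩
  · exact ⟨y - r, by simp; linear_combination hy - 3 * hr⟩

theorem sq_eq_one_mod_three : ∀ x : ZMod 3, x ^ 2 = 1 → x = 1 ∨ x = -1 := by decide

/-- The action of `F(ℤ[1/3])` on the quaternions over `ℚ₃`. -/
def padicAut : F ZThird →* (ℍ[ℚ_[3]] ≃ₐ[ℚ_[3]] ℍ[ℚ_[3]]) :=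
  (AlgEquiv.autCongr (hurwitzEquiv ℚ_[3])).toMonoidHom.comp (F.map (ZThird.toField ℚ_[3]))

theorem padicAut_apply (σ : F ZThird) (x : ℍ[ℚ_[3]]) : padicAut σ x = hurwitzEquiv ℚ_[3]
    (F.map (ZThird.toField ℚ_[3]) σ ((hurwitzEquiv ℚ_[3]).symm x)) := rfl

/-- The subgroup of `F(ℤ[1/3])` generated by the conjugations by `±i ± j ± k`, `±i ± j`, `±j ± k`
and `±k ± i`. -/
def conjSubgroup : Subgroup (F ZThird) := Subgroup.closure (hurwitzConjugations ZThird)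

theorem F.map_conj {R S : Type*} [CommRing R] [CommRing S] (f : R →+* S) (c : F R) (h : Hurwitz)
    (hc : ConjugatesBy c h) (y : S ⊗[ℤ] Hurwitz) :
    F.map f c y * ((1 : S) ⊗ₜ[ℤ] h) = ((1 : S) ⊗ₜ[ℤ] h) * y := by
  have h1 : extend f ((1 : R) ⊗ₜ[ℤ] h) = (1 : S) ⊗ₜ[ℤ] h := by simp [extend]
  induction y using TensorProduct.induction_on with
  | zero => simp
  | add x y hx hy => rw [map_add, add_mul, mul_add, hx, hy]
  | tmul s g =>
    have h2 : s ⊗ₜ[ℤ] g = s • extend f ((1 : R) ⊗ₜ[ℤ] g) := by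
      simp [extend, TensorProduct.smul_tmul']
    rw [h2, map_smul, smul_mul_assoc, mul_smul_comm, ← extend_apply, ← h1, ← map_mul, hc, map_mul]

/-- The conjugations by Hurwitz quaternions, as rotations by `π`. -/
theorem exists_rot {n : Fin 3 → ℤ} {h : Hurwitz} (hh : h ∈ diagonals ∪ midpoints)
    (hn : (h : ℍ[ℚ]) = quat 0 (n 0) (n 1) (n 2)) : ∃ δ ∈ conjSubgroup, ∀ v a,
      ((∑ i, n i ^ 2 : ℤ) : ℚ_[3]) * (rot (padicAut δ)).mulVec v a =
        2 * (∑ i, (n i : ℚ_[3]) * v i) * n a - ((∑ i, n i ^ 2 : ℤ) : ℚ_[3]) * v a := by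
  obtain ⟨c, hc⟩ := exists_conj ZThird.isUnit_three hh
  refine ⟨c, Subgroup.subset_closure ⟨h, hh, hc⟩, fun v a => ?_⟩
  have h1 : hurwitzEquiv ℚ_[3] (1 ⊗ₜ h) = ofVec (fun i => (n i : ℚ_[3])) := by
    rw [hurwitzEquiv_one_tmul, hn]
    ext <;> simp
  have := rot_conj (padicAut c) (fun i => (n i : ℚ_[3])) (fun x => by
    have h2 := F.map_conj (ZThird.toField ℚ_[3]) c h hc ((hurwitzEquiv ℚ_[3]).symm x)
    have h3 := congrArg (hurwitzEquiv ℚ_[3]) h2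
    rw [map_mul, map_mul, h1, AlgEquiv.apply_symm_apply] at h3
    exact h3) v a
  simpa [dotProduct, sq] using this

/-- The rotation by `π` about a diagonal of the cube. -/
theorem exists_rot_diagonal (n : Fin 3 → ℤ) (hn : ∀ i, n i = 1 ∨ n i = -1) :
    ∃ δ ∈ conjSubgroup, ∀ v a, 3 * (rot (padicAut δ)).mulVec v a =
        2 * (∑ i, (n i : ℚ_[3]) * v i) * n a - 3 * v a := by
  have hcast : ∀ i, (n i : ℚ) = 1 ∨ (n i : ℚ) = -1 := fun i => by
    rcases hn i with h | h <;> simp [h]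
  have h3 : ∑ i, n i ^ 2 = 3 := by
    have : ∀ i, n i ^ 2 = 1 := fun i => by rcases hn i with h | h <;> simp [h]
    simp [this]
  have hmem : quat 0 (n 0) (n 1) (n 2) ∈ Hurwitz :=
    mem_span_hurwitzUnits.2 ⟨0, n 0, n 1, n 2, 0, by ext <;> simp⟩
  obtain ⟨δ, hδ, H⟩ := exists_rot (n := n) (h := ⟨_, hmem⟩)
    (Or.inl ⟨_, _, _, hcast 0, hcast 1, hcast 2, rfl⟩) rfl
  rw [h3] at H
  exact ⟨δ, hδ, H⟩

/-- The descent step: the largest power of `3` in the denominators of a rotation is lowered by a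
rotation about a diagonal of the cube. The columns of the matrix, cleared of denominators, are
isotropic and pairwise orthogonal modulo `9`. A column which is nonzero modulo `3` is there
congruent to a diagonal `n` of the cube, and the rotation about `n` makes all columns divisible
by `3`. -/
theorem exists_descent (m : ℕ) (τ : ℍ[ℚ_[3]] ≃ₐ[ℚ_[3]] ℍ[ℚ_[3]])
    (hτ : ∀ a b, ‖(3 : ℚ_[3]) ^ (m + 1) * rot τ a b‖ ≤ 1) :
    ∃ δ ∈ conjSubgroup, ∀ a b, ‖(3 : ℚ_[3]) ^ m * rot (padicAut δ * τ) a b‖ ≤ 1 := by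
  obtain ⟨N, hN⟩ : ∃ N : Fin 3 → Fin 3 → ℤ_[3], ∀ a b,
      (N a b : ℚ_[3]) = 3 ^ (m + 1) * rot τ a b := ⟨fun a b => ⟨_, hτ a b⟩, fun a b => rfl⟩
  have horth : ∀ b c, (9 : ℤ_[3]) ∣ ∑ a, N a b * N a c := by
    intro b c
    refine ⟨9 ^ m * if b = c then 1 else 0, ?_⟩
    have h : ((∑ a, N a b * N a c : ℤ_[3]) : ℚ_[3]) =
        ((9 * (9 ^ m * if b = c then 1 else 0) : ℤ_[3]) : ℚ_[3]) := by
      have h9 : ((9 : ℤ_[3]) : ℚ_[3]) = 9 := rfl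
      have h1 := rot_orthogonal τ b c
      have h2 : (9 : ℚ_[3]) ^ m = 3 ^ (2 * m) := by rw [pow_mul]; norm_num
      rw [Fin.sum_univ_three] at h1 ⊢
      push_cast
      rw [hN, hN, hN, hN, hN, hN, h9, h2]
      have h3 : (((if b = c then 1 else 0 : ℤ_[3]) : ℤ_[3]) : ℚ_[3]) = if b = c then 1 else 0 := by
        split_ifs <;> rfl
      rw [h3]
      linear_combination 9 * 3 ^ (2 * m) * h1
    exact PadicInt.ext h
  have hdiv : ∀ (x : ℤ_[3]) (y : ℚ_[3]), 3 * (3 ^ m * y) = (x : ℚ_[3]) → (3 : ℤ_[3]) ∣ x →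
      ‖(3 : ℚ_[3]) ^ m * y‖ ≤ 1 := by
    rintro _ y hy ⟨z, rfl⟩
    have : (3 : ℚ_[3]) ^ m * y = z := by
      apply mul_left_cancel₀ (three_ne_zero : (3 : ℚ_[3]) ≠ 0)
      rw [hy]; push_cast; rfl
    rw [this]
    exact z.2
  by_cases hall : ∀ a b, (3 : ℤ_[3]) ∣ N a b
  · refine ⟨1, one_mem _, fun a b => hdiv (N a b) _ ?_ (hall a b)⟩
    rw [map_one, one_mul, hN]; ring
  push Not at hall
  obtain ⟨a₀, b₀, h0⟩ := hall
  have hsq : ∀ a, PadicInt.toZMod (N a b₀) ^ 2 = 1 := by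
    have h := (toZMod_eq_zero_iff _).2 (dvd_trans ⟨3, by norm_num⟩ (horth b₀ b₀))
    rw [← toZMod_eq_zero_iff] at h0
    simp only [Fin.sum_univ_three, ← sq, map_add, map_pow] at h
    intro a
    have key : PadicInt.toZMod (N 0 b₀) ^ 2 = 1 ∧ PadicInt.toZMod (N 1 b₀) ^ 2 = 1 ∧
        PadicInt.toZMod (N 2 b₀) ^ 2 = 1 := by
      refine sum_sq_mod_three _ _ _ h ?_
      fin_cases a₀
      exacts [Or.inl h0, Or.inr (Or.inl h0), Or.inr (Or.inr h0)]
    fin_cases a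
    exacts [key.1, key.2.1, key.2.2]
  have hn : ∀ a, ∃ n : ℤ, (n = 1 ∨ n = -1) ∧ (3 : ℤ_[3]) ∣ n * N a b₀ - 1 := by
    intro a
    rcases sq_eq_one_mod_three _ (hsq a) with h | h
    · exact ⟨1, Or.inl rfl, (toZMod_eq_zero_iff _).1 (by simp [h])⟩
    · exact ⟨-1, Or.inr rfl, (toZMod_eq_zero_iff _).1 (by simp [h])⟩
  choose n hn1 hn2 using hn
  have hnn : ∀ a, (n a : ℤ_[3]) ^ 2 = 1 := fun a => by
    rcases hn1 a with h | h <;> simp [h]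
  obtain ⟨δ, hδ, H⟩ := exists_rot_diagonal n hn1
  refine ⟨δ, hδ, fun a b => ?_⟩
  obtain ⟨y, hy⟩ := nine_dvd_of_orthogonal (u := fun i => n i * N i b₀) (w := fun i => n i * N i b)
    hn2 (by convert horth b₀ b₀ using 2 with i; linear_combination N i b₀ ^ 2 * hnn i)
    (by convert horth b₀ b using 2 with i; linear_combination N i b₀ * N i b * hnn i)
    (by convert horth b b using 2 with i; linear_combination N i b ^ 2 * hnn i) a
  refine hdiv (3 * (n a * y)) _ ?_ ⟨_, rfl⟩
  have hmul : rot (padicAut δ * τ) a b = (rot (padicAut δ)).mulVec (fun i => rot τ i b) a := by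
    rw [map_mul]; rfl
  have H1 := H (fun i => rot τ i b) a
  rw [← hmul] at H1
  have hy' : 2 * ∑ i, (n i : ℚ_[3]) * N i b - 3 * (n a * N a b) = 9 * y := by
    have := congrArg (fun x : ℤ_[3] => (x : ℚ_[3])) hy
    push_cast at this
    exact this
  have hnn' : (n a : ℚ_[3]) ^ 2 = 1 := by rcases hn1 a with h | h <;> simp [h]
  have hs : ∑ i, (n i : ℚ_[3]) * N i b = 3 ^ (m + 1) * ∑ i, (n i : ℚ_[3]) * rot τ i b := by
    rw [Finset.mul_sum]
    exact Finset.sum_congr rfl fun i _ => by rw [hN]; ring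
  rw [hs, hN] at hy'
  apply mul_left_cancel₀ (three_ne_zero : (3 : ℚ_[3]) ≠ 0)
  have h3 : ((3 : ℤ_[3]) : ℚ_[3]) = 3 := rfl
  push_cast
  rw [h3]
  linear_combination 3 ^ (m + 1) * H1 + n a * hy' + 3 ^ (m + 2) * rot τ a b * hnn'

/-- Every rotation over `ℚ₃` is made integral by a product of rotations about diagonals of the
cube. -/
theorem exists_integral (τ : ℍ[ℚ_[3]] ≃ₐ[ℚ_[3]] ℍ[ℚ_[3]]) :
    ∃ δ ∈ conjSubgroup, ∀ a b, ‖rot (padicAut δ * τ) a b‖ ≤ 1 := by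
  have key : ∀ (m : ℕ) (τ : ℍ[ℚ_[3]] ≃ₐ[ℚ_[3]] ℍ[ℚ_[3]]),
      (∀ a b, ‖(3 : ℚ_[3]) ^ m * rot τ a b‖ ≤ 1) →
      ∃ δ ∈ conjSubgroup, ∀ a b, ‖rot (padicAut δ * τ) a b‖ ≤ 1 := by
    intro m
    induction m with
    | zero =>
      intro τ hτ
      exact ⟨1, one_mem _, by simpa using hτ⟩
    | succ m ih =>
      intro τ hτ
      obtain ⟨δ, hδ, h⟩ := exists_descent m τ hτ
      obtain ⟨γ, hγ, h'⟩ := ih _ h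
      exact ⟨γ * δ, mul_mem hγ hδ, by simpa [mul_assoc] using h'⟩
  have hb : ∀ a b, ∃ m : ℕ, ‖rot τ a b‖ ≤ 3 ^ m := fun a b =>
    (pow_unbounded_of_one_lt ‖rot τ a b‖ (by norm_num : (1 : ℝ) < 3)).imp fun _ h => h.le
  choose f hf using hb
  refine key (∑ a, ∑ b, f a b) τ fun a b => ?_
  have hle : f a b ≤ ∑ a, ∑ b, f a b :=
    (Finset.single_le_sum (f := fun b => f a b) (fun _ _ => Nat.zero_le _)
      (Finset.mem_univ b)).trans
      (Finset.single_le_sum (f := fun a => ∑ b, f a b) (fun _ _ => Nat.zero_le _)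
        (Finset.mem_univ a))
  have h3 : ‖(3 : ℚ_[3])‖ = 3⁻¹ := by
    have := Padic.norm_p (p := 3)
    exact_mod_cast this
  rw [norm_mul, norm_pow, h3, inv_pow, inv_mul_le_iff₀ (by positivity), mul_one]
  exact (hf a b).trans (pow_le_pow_right₀ (by norm_num) hle)

/-! ### Reduction modulo `3` -/

/-- The axes of the rotations by `π` given by the quaternions `±i ± j`, `±j ± k`, `±k ± i`. -/
def axes : List (Fin 3 → ℤ) :=
  [![0, 1, 1], ![0, 1, -1], ![1, 0, 1], ![1, 0, -1], ![1, 1, 0], ![1, -1, 0]]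

/-- The rotation by `π` about an axis `n` of square length `2`. -/
def halfTurn {R : Type*} [CommRing R] (n : Fin 3 → ℤ) (v : Fin 3 → R) : Fin 3 → R :=
  fun i => (n 0 * v 0 + n 1 * v 1 + n 2 * v 2) * n i - v i

/-- Whether at most `m` rotations by `π` about the axes in `axes` can move the vectors `u`, `v`
to the first two standard basis vectors. -/
def IsReducible : ℕ → (Fin 3 → ZMod 3) → (Fin 3 → ZMod 3) → Bool
  | 0, u, v => decide (u = ![1, 0, 0] ∧ v = ![0, 1, 0])
  | m + 1, u, v => IsReducible m u v ||
      axes.any fun n => IsReducible m (halfTurn n u) (halfTurn n v)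

/-- The rotation group of the cube maps onto `SO₃(𝔽₃)`, and its elements are products of at most
three of the rotations by `π` (they correspond to the transpositions in `S₄`). -/
theorem isReducible_of_orthonormal : ∀ u0 u1 u2 v0 v1 v2 : ZMod 3, u0 ^ 2 + u1 ^ 2 + u2 ^ 2 = 1 →
    v0 ^ 2 + v1 ^ 2 + v2 ^ 2 = 1 → u0 * v0 + u1 * v1 + u2 * v2 = 0 →
    IsReducible 3 ![u0, u1, u2] ![v0, v1, v2] = true := by
  decide +kernel

theorem exists_rot_axis {n : Fin 3 → ℤ} (hn : n ∈ axes) :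
    ∃ δ ∈ conjSubgroup, ∀ v, (rot (padicAut δ)).mulVec v = halfTurn n v := by
  have hmem : quat 0 (n 0) (n 1) (n 2) ∈ Hurwitz :=
    mem_span_hurwitzUnits.2 ⟨0, n 0, n 1, n 2, 0, by ext <;> simp⟩
  have key : (⟨_, hmem⟩ : Hurwitz) ∈ midpoints ∧ ∑ i, n i ^ 2 = 2 := by
    rw [Fin.sum_univ_three]
    simp only [axes, List.mem_cons, List.not_mem_nil, or_false] at hn
    rcases hn with rfl | rfl | rfl | rfl | rfl | rfl
    · exact ⟨⟨1, 1, by simp, by simp, Or.inr (Or.inl (by simp))⟩, by simp⟩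
    · exact ⟨⟨1, -1, by simp, by simp, Or.inr (Or.inl (by simp))⟩, by simp⟩
    · exact ⟨⟨1, 1, by simp, by simp, Or.inr (Or.inr (by simp))⟩, by simp⟩
    · exact ⟨⟨-1, 1, by simp, by simp, Or.inr (Or.inr (by simp))⟩, by simp⟩
    · exact ⟨⟨1, 1, by simp, by simp, Or.inl (by simp)⟩, by simp⟩
    · exact ⟨⟨1, -1, by simp, by simp, Or.inl (by simp)⟩, by simp⟩
  obtain ⟨δ, hδ, H⟩ := exists_rot (n := n) (Or.inr key.1) rfl
  refine ⟨δ, hδ, fun v => funext fun a => ?_⟩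
  have h := H v a
  rw [key.2, Fin.sum_univ_three] at h
  push_cast at h
  simp only [halfTurn]
  linear_combination h / 2

/-- A reduction of the first two columns modulo `3` lifts to the rotation itself. -/
theorem exists_reduction (m : ℕ) : ∀ (τ : ℍ[ℚ_[3]] ≃ₐ[ℚ_[3]] ℍ[ℚ_[3]])
    (N : Fin 3 → Fin 3 → ℤ_[3]), (∀ b a, (N b a : ℚ_[3]) = rot τ a b) →
    IsReducible m (fun i => PadicInt.toZMod (N 0 i)) (fun i => PadicInt.toZMod (N 1 i)) = true →
    ∃ δ ∈ conjSubgroup, ∃ N' : Fin 3 → Fin 3 → ℤ_[3],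
      (∀ b a, (N' b a : ℚ_[3]) = rot (padicAut δ * τ) a b) ∧
      (fun i => PadicInt.toZMod (N' 0 i)) = ![1, 0, 0] ∧
      (fun i => PadicInt.toZMod (N' 1 i)) = ![0, 1, 0] := by
  induction m with
  | zero =>
    intro τ N hN h
    exact ⟨1, one_mem _, N, by simpa using hN, of_decide_eq_true h⟩
  | succ m ih =>
    intro τ N hN h
    rw [IsReducible, Bool.or_eq_true, List.any_eq_true] at h
    rcases h with h | ⟨n, hn, h⟩
    · exact ih τ N hN h
    obtain ⟨δ, hδ, H⟩ := exists_rot_axis hn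
    have hred : ∀ b, (fun i => PadicInt.toZMod (halfTurn n (N b) i)) =
        halfTurn n (fun i => PadicInt.toZMod (N b i)) := fun b => by
      funext i; simp [halfTurn]
    obtain ⟨γ, hγ, N', hN', hh⟩ := ih (padicAut δ * τ) (fun b => halfTurn n (N b)) (fun b a => by
      have h1 : rot (padicAut δ * τ) a b = (rot (padicAut δ)).mulVec (fun i => rot τ i b) a := by
        rw [map_mul]; rfl
      rw [h1, H]
      simp only [halfTurn, ← hN]
      push_cast
      rfl) (by rw [hred, hred]; exact h)
    exact ⟨γ * δ, mul_mem hγ hδ, N', by simpa [mul_assoc] using hN', hh⟩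

theorem norm_lt_one_of_toZMod {x : ℤ_[3]} (h : PadicInt.toZMod x = 0) : ‖(x : ℚ_[3])‖ < 1 := by
  rw [toZMod_eq_zero_iff] at h
  exact (PadicInt.norm_lt_one_iff_dvd x).2 (by exact_mod_cast h)

/-- Strong approximation for the rotation group: every rotation over `ℚ₃` can be moved into the
congruence subgroup modulo `3` by a product of conjugations by Hurwitz quaternions. -/
theorem exists_congr_one (τ : ℍ[ℚ_[3]] ≃ₐ[ℚ_[3]] ℍ[ℚ_[3]]) :
    ∃ δ ∈ conjSubgroup, ∀ a b,
      ‖rot (padicAut δ * τ) a b - (1 : Matrix (Fin 3) (Fin 3) ℚ_[3]) a b‖ < 1 := by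
  obtain ⟨δ, hδ, hint⟩ := exists_integral τ
  obtain ⟨N, hN⟩ : ∃ N : Fin 3 → Fin 3 → ℤ_[3], ∀ b a,
      (N b a : ℚ_[3]) = rot (padicAut δ * τ) a b := ⟨fun b a => ⟨_, hint a b⟩, fun b a => rfl⟩
  have horth : ∀ b c, PadicInt.toZMod (N b 0) * PadicInt.toZMod (N c 0) +
      PadicInt.toZMod (N b 1) * PadicInt.toZMod (N c 1) +
      PadicInt.toZMod (N b 2) * PadicInt.toZMod (N c 2) = if b = c then 1 else 0 := by
    intro b c
    have h := rot_orthogonal (padicAut δ * τ) b c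
    have h1 : N b 0 * N c 0 + N b 1 * N c 1 + N b 2 * N c 2 = if b = c then 1 else 0 := by
      apply PadicInt.ext
      rw [Fin.sum_univ_three, ← hN, ← hN, ← hN, ← hN, ← hN, ← hN] at h
      refine Eq.trans ?_ (h.trans ?_)
      · rfl
      · split_ifs <;> rfl
    have h2 := congrArg PadicInt.toZMod h1
    simp only [map_add, map_mul] at h2
    rw [h2]
    split_ifs <;> simp
  have heta : ∀ b, (fun i => PadicInt.toZMod (N b i)) =
      ![PadicInt.toZMod (N b 0), PadicInt.toZMod (N b 1), PadicInt.toZMod (N b 2)] := fun b => by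
    funext i; fin_cases i <;> rfl
  obtain ⟨γ, hγ, M, hM, hu, hv⟩ := exists_reduction 3 _ N hN (by
    rw [heta, heta]
    exact isReducible_of_orthonormal _ _ _ _ _ _ (by simpa [sq] using horth 0 0)
      (by simpa [sq] using horth 1 1) (by simpa using horth 0 1))
  refine ⟨γ * δ, mul_mem hγ hδ, fun a b => ?_⟩
  rw [map_mul padicAut, mul_assoc, ← hM]
  -- The third column is determined modulo `3` by the first two.
  have hcross := rot_cross (padicAut γ * (padicAut δ * τ))
  simp only [← hM] at hcross
  obtain ⟨c0, c1, c2⟩ := hcross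
  have c0' : M 2 0 = M 0 1 * M 1 2 - M 0 2 * M 1 1 := PadicInt.ext c0
  have c1' : M 2 1 = M 0 2 * M 1 0 - M 0 0 * M 1 2 := PadicInt.ext c1
  have c2' : M 2 2 = M 0 0 * M 1 1 - M 0 1 * M 1 0 := PadicInt.ext c2
  have hred : ∀ i j, PadicInt.toZMod (M i j) = (1 : Matrix (Fin 3) (Fin 3) (ZMod 3)) j i := by
    intro i j
    have u0 := congrFun hu 0
    have u1 := congrFun hu 1
    have u2 := congrFun hu 2
    have v0 := congrFun hv 0
    have v1 := congrFun hv 1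
    have v2 := congrFun hv 2
    simp at u0 u1 u2 v0 v1 v2
    fin_cases i <;> fin_cases j <;> simp [u0, u1, u2, v0, v1, v2, c0', c1', c2']
  have hsub : (M b a : ℚ_[3]) - (1 : Matrix (Fin 3) (Fin 3) ℚ_[3]) a b =
      ((M b a - (1 : Matrix (Fin 3) (Fin 3) ℤ_[3]) a b : ℤ_[3]) : ℚ_[3]) := by
    rw [Matrix.one_apply, Matrix.one_apply]
    split_ifs <;> simp
  rw [hsub]
  apply norm_lt_one_of_toZMod
  rw [map_sub, hred, Matrix.one_apply, Matrix.one_apply]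
  split_ifs <;> simp

/-! ### Automorphisms defined over `ℤ[1/3]` -/

/-- Coordinates of an element of `R ⊗ ℋ` with respect to a basis of `ℋ` together with one redundant
generator, seen in the quaternions over a field. -/
theorem exists_coordinates {R K : Type*} [CommRing R] [Field K] [CharZero K] (f : R →+* K)
    (y : R ⊗[ℤ] Hurwitz) : ∃ a b c d e : R, hurwitzEquiv K (extend f y) =
      quatOf (f a + f e / 2) (f b + f e / 2) (f c + f e / 2) (f d + f e / 2) := by
  induction y using TensorProduct.induction_on with
  | zero => exact ⟨0, 0, 0, 0, 0, by rw [map_zero, map_zero]; ext <;> simp⟩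
  | add x y hx hy =>
    obtain ⟨a, b, c, d, e, h⟩ := hx
    obtain ⟨a', b', c', d', e', h'⟩ := hy
    refine ⟨a + a', b + b', c + c', d + d', e + e', ?_⟩
    rw [map_add, map_add, h, h']
    ext <;> simp <;> ring
  | tmul r h =>
    obtain ⟨a, b, c, d, e, rfl⟩ := exists_eq_hur h
    refine ⟨r * a, r * b, r * c, r * d, r * e, ?_⟩
    have h1 : extend f (r ⊗ₜ[ℤ] hur a b c d e) = f r • ((1 : K) ⊗ₜ[ℤ] hur a b c d e) := by
      simp [extend, TensorProduct.smul_tmul']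
    rw [h1, map_smul, hurwitzEquiv_one_tmul]
    ext <;> simp [hur] <;> ring

/-- An automorphism of `ℋ ⊗ ℤ[1/3]` acts on the imaginary quaternions by a matrix over `ℤ[1/3]`. -/
theorem exists_rot_eq (σ : F ZThird) (a b : Fin 3) :
    ∃ x : ZThird, rot (padicAut σ) a b = ZThird.toField ℚ_[3] x := by
  obtain ⟨h, hh⟩ : ∃ h : Hurwitz, quatCast ℚ_[3] h = ofVec (Pi.single b 1) := by
    fin_cases b
    · exact ⟨hur 0 1 0 0 0, by ext <;> simp [hur]⟩
    · exact ⟨hur 0 0 1 0 0, by ext <;> simp [hur]⟩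
    · exact ⟨hur 0 0 0 1 0, by ext <;> simp [hur]⟩
  obtain ⟨r0, r1, r2, r3, r4, hr⟩ := exists_coordinates (ZThird.toField ℚ_[3]) (σ (1 ⊗ₜ h))
  have h1 : padicAut σ (ofVec (Pi.single b 1)) =
      hurwitzEquiv ℚ_[3] (extend (ZThird.toField ℚ_[3]) (σ (1 ⊗ₜ h))) := by
    rw [extend_apply, ← hh, ← hurwitzEquiv_one_tmul]
    have : extend (ZThird.toField ℚ_[3]) (1 ⊗ₜ h) = (1 : ℚ_[3]) ⊗ₜ h := by simp [extend]
    rw [this, padicAut_apply, AlgEquiv.symm_apply_apply]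
  have h2 := re_map (padicAut σ) (ofVec (Pi.single b 1))
  rw [h1, hr, quatOf_re, ofVec_re] at h2
  rw [rot_apply, h1, hr]
  fin_cases a
  · exact ⟨r1 - r0, by simp; linear_combination h2⟩
  · exact ⟨r2 - r0, by simp; linear_combination h2⟩
  · exact ⟨r3 - r0, by simp; linear_combination h2⟩

theorem exists_int_of_norm_le_one (x : ZThird) (hx : ‖ZThird.toField ℚ_[3] x‖ ≤ 1) :
    ∃ z : ℤ, ZThird.toField ℚ_[3] x = z := by
  obtain ⟨n, z, h⟩ := ZThird.exists_eq x
  have h1 := congrArg (ZThird.toField ℚ_[3]) h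
  simp only [map_mul, map_pow, map_ofNat, map_intCast] at h1
  have h3 : ‖(3 : ℚ_[3])‖ = 3⁻¹ := by
    have := Padic.norm_p (p := 3)
    exact_mod_cast this
  have h2 : ‖(z : ℚ_[3])‖ ≤ ((3 : ℕ) : ℝ) ^ (-n : ℤ) := by
    rw [← h1, norm_mul, norm_pow, h3]
    simpa using mul_le_mul_of_nonneg_right hx (by positivity : (0 : ℝ) ≤ 3⁻¹ ^ n)
  rw [Padic.norm_int_le_pow_iff_dvd] at h2
  obtain ⟨w, rfl⟩ := h2
  refine ⟨w, mul_right_cancel₀ (pow_ne_zero n (by norm_num : (3 : ℚ_[3]) ≠ 0)) ?_⟩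
  rw [h1]; push_cast; ring

theorem padicAut_injective : Function.Injective padicAut := by
  intro σ τ h
  exact F.map_injective (ZThird.toField_injective ℚ_[3])
    ((AlgEquiv.autCongr (hurwitzEquiv ℚ_[3])).injective h)

/-- The group `F(ℤ[1/3])` meets the congruence subgroup modulo `3` trivially: the matrices in
question are orthogonal with integral entries. -/
theorem eq_one_of_congr_one {σ : F ZThird} (h : ∀ a b,
    ‖rot (padicAut σ) a b - (1 : Matrix (Fin 3) (Fin 3) ℚ_[3]) a b‖ < 1) : σ = 1 := by
  have hone : ∀ a b, (1 : Matrix (Fin 3) (Fin 3) ℚ_[3]) a b =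
      ((1 : Matrix (Fin 3) (Fin 3) ℤ) a b : ℤ) := fun a b => by
    rw [Matrix.one_apply, Matrix.one_apply]; split_ifs <;> simp
  have hint : ∀ a b, ∃ z : ℤ, rot (padicAut σ) a b = z := by
    intro a b
    obtain ⟨x, hx⟩ := exists_rot_eq σ a b
    rw [hx]
    apply exists_int_of_norm_le_one
    rw [← hx, ← sub_add_cancel (rot (padicAut σ) a b)
      ((1 : Matrix (Fin 3) (Fin 3) ℚ_[3]) a b)]
    refine (Padic.nonarchimedean _ _).trans (max_le (h a b).le ?_)
    rw [hone]
    exact Padic.norm_int_le_one _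
  choose A hA using hint
  have hdvd : ∀ a b, (3 : ℤ) ∣ A a b - (1 : Matrix (Fin 3) (Fin 3) ℤ) a b := by
    intro a b
    have := h a b
    rw [hA, hone, ← Int.cast_sub, Padic.norm_intCast_lt_one_iff] at this
    exact_mod_cast this
  have horth : ∀ b, A 0 b ^ 2 + A 1 b ^ 2 + A 2 b ^ 2 = 1 := by
    intro b
    have := rot_orthogonal (padicAut σ) b b
    simp only [Fin.sum_univ_three, hA, if_true] at this
    rw [sq, sq, sq]
    exact_mod_cast this
  have key : ∀ x y z : ℤ, x ^ 2 + y ^ 2 + z ^ 2 = 1 → (3 : ℤ) ∣ x - 1 →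
      x = 1 ∧ y = 0 ∧ z = 0 := by
    intro x y z h1 h2
    have hx : x ≠ 0 := by rintro rfl; omega
    have hx2 : 0 < x ^ 2 := by positivity
    have hy : y ^ 2 = 0 := by nlinarith [sq_nonneg y, sq_nonneg z]
    have hz : z ^ 2 = 0 := by nlinarith [sq_nonneg y, sq_nonneg z]
    have hx1 : (x - 1) * (x + 1) = 0 := by nlinarith
    refine ⟨?_, by simpa using hy, by simpa using hz⟩
    rcases mul_eq_zero.1 hx1 with h | h <;> omega
  have hA1 : rot (padicAut σ) = 1 := by
    ext a b
    rw [hA, hone]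
    congr 1
    have h0 := key _ _ _ (horth 0) (by simpa using hdvd 0 0)
    have h1 := key (A 1 1) (A 0 1) (A 2 1) (by rw [← horth 1]; ring) (by simpa using hdvd 1 1)
    have h2 := key (A 2 2) (A 0 2) (A 1 2) (by rw [← horth 2]; ring) (by simpa using hdvd 2 2)
    fin_cases a <;> fin_cases b <;> simp [h0, h1, h2]
  apply padicAut_injective
  apply rot_injective
  rw [hA1, map_one, map_one]

/-- The group `F(ℤ[1/3])` is generated by the conjugations by `±i ± j ± k`, `±i ± j`, `±j ± k`,
`±k ± i`. -/
theorem conjSubgroup_eq_top : conjSubgroup = ⊤ := by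
  rw [eq_top_iff]
  intro σ _
  obtain ⟨δ, hδ, h⟩ := exists_congr_one (padicAut σ)
  rw [← map_mul] at h
  have := eq_one_of_congr_one h
  rw [eq_inv_of_mul_eq_one_right this]
  exact inv_mem hδ

/-! ### `PGL₂` as the automorphism group of the quaternions -/

section PGLAut
variable {K : Type*} [Field K] [CharZero K] (ψ : K ⊗[ℤ] Hurwitz ≃ₐ[K] M₂ K)

/-- The isomorphism `ℍ[K] ≅ M₂(K)` given by an isomorphism `K ⊗ ℋ ≅ M₂(K)`. -/
def splitting : ℍ[K] ≃ₐ[K] M₂ K := (hurwitzEquiv K).symm.trans ψ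

/-- The isomorphism `PGL₂(K) ≅ Aut(ℍ[K])`. -/
def pglAut : PGL(2, K) ≃* (ℍ[K] ≃ₐ[K] ℍ[K]) :=
  (FEquivPGL ψ).symm.trans (AlgEquiv.autCongr (hurwitzEquiv K))

theorem pglAut_mk (A : GL (Fin 2) K) (x : ℍ[K]) :
    pglAut ψ (Matrix.ProjGenLinGroup.mk A) x =
      (splitting ψ).symm ((A : M₂ K) * splitting ψ x * ((A⁻¹ : GL (Fin 2) K) : M₂ K)) := rfl

theorem pglAut_eq_mk_iff (A : GL (Fin 2) K) (σ : ℍ[K] ≃ₐ[K] ℍ[K]) :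
    pglAut ψ (Matrix.ProjGenLinGroup.mk A) = σ ↔
      ∀ x, splitting ψ (σ x) * (A : M₂ K) = (A : M₂ K) * splitting ψ x := by
  have h : ∀ x, pglAut ψ (Matrix.ProjGenLinGroup.mk A) x = σ x ↔
      splitting ψ (σ x) * (A : M₂ K) = (A : M₂ K) * splitting ψ x := by
    intro x
    rw [pglAut_mk, AlgEquiv.symm_apply_eq]
    constructor
    · intro h
      rw [← h, mul_assoc, Units.inv_mul, mul_one]
    · intro h
      rw [← h, mul_assoc, Units.mul_inv, mul_one]
  rw [AlgEquiv.ext_iff]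
  exact forall_congr' h

/-- The quaternion `∑ σ(e) e⁻¹`, the sum running over `e = 1, i, j, k`. It intertwines `σ` with the
identity, so that `σ` is the conjugation by it as soon as it is invertible. -/
def intertwiner (σ : ℍ[K] ≃ₐ[K] ℍ[K]) : ℍ[K] :=
  1 - ∑ b, σ (ofVec (Pi.single b 1)) * ofVec (Pi.single b 1)

theorem intertwiner_spec (σ : ℍ[K] ≃ₐ[K] ℍ[K]) (x : ℍ[K]) :
    σ x * intertwiner σ = intertwiner σ * x := by
  obtain ⟨M, hM⟩ : ∃ M : Matrix (Fin 3) (Fin 3) K, rot σ = M := ⟨_, rfl⟩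
  set i : ℍ[K] := ofVec (Pi.single 0 1) with hi
  set j : ℍ[K] := ofVec (Pi.single 1 1) with hj
  set k : ℍ[K] := ofVec (Pi.single 2 1) with hk
  have ii : i * i = -1 := by rw [hi]; ext <;> simp
  have jj : j * j = -1 := by rw [hj]; ext <;> simp
  have kk : k * k = -1 := by rw [hk]; ext <;> simp
  have ij : i * j = k := by rw [hi, hj, hk]; ext <;> simp
  have ji : j * i = -k := by rw [hi, hj, hk]; ext <;> simp
  have jk : j * k = i := by rw [hi, hj, hk]; ext <;> simp
  have kj : k * j = -i := by rw [hi, hj, hk]; ext <;> simp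
  have ki : k * i = j := by rw [hi, hj, hk]; ext <;> simp
  have ik : i * k = -j := by rw [hi, hj, hk]; ext <;> simp
  have σm : ∀ x y z, x * y = z → ∀ w, σ x * (σ y * w) = σ z * w := fun x y z h w => by
    rw [← mul_assoc, ← map_mul, h]
  have hq : intertwiner σ = 1 - (σ i * i + σ j * j + σ k * k) := by
    rw [intertwiner, Fin.sum_univ_three]
  have h1 : σ i * intertwiner σ = intertwiner σ * i := by
    rw [hq]
    simp only [mul_sub, sub_mul, mul_add, add_mul, mul_one, one_mul, mul_assoc, σm _ _ _ ii,
      σm _ _ _ ij, σm _ _ _ ik, ii, ji, ki, map_neg, map_one]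
    noncomm_ring
  have h2 : σ j * intertwiner σ = intertwiner σ * j := by
    rw [hq]
    simp only [mul_sub, sub_mul, mul_add, add_mul, mul_one, one_mul, mul_assoc, σm _ _ _ ji,
      σm _ _ _ jj, σm _ _ _ jk, ij, jj, kj, map_neg, map_one]
    noncomm_ring
  have h3 : σ k * intertwiner σ = intertwiner σ * k := by
    rw [← ij, map_mul, mul_assoc, h2, ← mul_assoc, h1, mul_assoc]
  have hx : x = x.re • (1 : ℍ[K]) + (x.imI • i + x.imJ • j + x.imK • k) := by
    rw [hi, hj, hk]; ext <;> simp
  rw [hx]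
  simp only [map_add, map_smul, map_one, add_mul, mul_add, smul_mul_assoc, mul_smul_comm, h1, h2,
    h3, one_mul, mul_one]

theorem splitting_intertwiner (σ : ℍ[K] ≃ₐ[K] ℍ[K]) : splitting ψ (intertwiner σ) =
    1 - ∑ b, (∑ a, rot σ a b • splitting ψ (ofVec (Pi.single a 1))) *
      splitting ψ (ofVec (Pi.single b 1)) := by
  have h : ∀ v : Fin 3 → K, ofVec v = ∑ a, v a • (ofVec (Pi.single a 1) : ℍ[K]) := fun v => by
    rw [Fin.sum_univ_three]; ext <;> simp
  rw [intertwiner, map_sub, map_sum, map_one]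
  congr 1
  refine Finset.sum_congr rfl fun b _ => ?_
  rw [map_mul, map_ofVec, Matrix.mulVec_single_one, h, map_sum]
  simp

end PGLAut

theorem pglAut_toPGL (ψ : ℚ_[3] ⊗[ℤ] Hurwitz ≃ₐ[ℚ_[3]] M₂ ℚ_[3]) (σ : F ZThird) :
    pglAut ψ (toPGL ψ σ) = padicAut σ := by
  rw [toPGL_apply, pglAut, MulEquiv.trans_apply, MulEquiv.symm_apply_apply]
  rfl

/-! ### Discreteness and maximality -/

section Topology
open Filter Topology

variable {K : Type*} [Field K] [TopologicalSpace K]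

/-- Matrices close to `1` come from elements of `GL₂` close to `1`. -/
theorem eventually_exists_GL [IsTopologicalRing K] [ContinuousInv₀ K] [T1Space K]
    {V : Set (GL (Fin 2) K)} (hV : IsOpen V)
    (h1 : (1 : GL (Fin 2) K) ∈ V) : ∀ᶠ B : M₂ K in 𝓝 1, ∃ A ∈ V, (A : M₂ K) = B := by
  obtain ⟨W, hW, rfl⟩ := Units.isInducing_embedProduct.isOpen_iff.1 hV
  have hdet : ∀ᶠ B : M₂ K in 𝓝 1, B.det ≠ 0 := by
    have : Continuous fun B : M₂ K => B.det := continuous_id.matrix_det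
    exact this.continuousAt.eventually_ne (by simp)
  have hinv : ContinuousAt (fun B : M₂ K => (B, MulOpposite.op B⁻¹)) 1 := by
    refine continuousAt_id.prodMk (MulOpposite.continuous_op.continuousAt.comp ?_)
    apply continuousAt_matrix_inv
    have : (Ring.inverse : K → K) = Inv.inv := funext Ring.inverse_eq_inv
    rw [this]
    exact continuousAt_inv₀ (by simp)
  have hW' : ∀ᶠ B : M₂ K in 𝓝 1, (B, MulOpposite.op B⁻¹) ∈ W := by
    apply hinv.eventually_mem
    apply hW.mem_nhds
    simpa using h1
  filter_upwards [hdet, hW'] with B hB hB'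
  refine ⟨Matrix.GeneralLinearGroup.mkOfDetNeZero B hB, ?_, rfl⟩
  rw [Set.mem_preimage, Units.embedProduct_apply, Matrix.coe_units_inv]
  exact hB'

end Topology

section Maximal
open Filter Topology

variable (ψ : ℚ_[3] ⊗[ℤ] Hurwitz ≃ₐ[ℚ_[3]] M₂ ℚ_[3])

theorem continuous_rot_pglAut (a b : Fin 3) : Continuous fun A : GL (Fin 2) ℚ_[3] =>
    rot (pglAut ψ (Matrix.ProjGenLinGroup.mk A)) a b := by
  simp only [rot_apply, pglAut_mk]
  let L : M₂ ℚ_[3] →ₗ[ℚ_[3]] ℚ_[3] :=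
    LinearMap.proj a ∘ₗ imVec ∘ₗ (splitting ψ).symm.toLinearMap
  have hL : Continuous L := L.continuous_of_finiteDimensional
  refine hL.comp ?_
  exact ((Units.continuous_val).mul continuous_const).mul Units.continuous_coe_inv

/-- The elements near `σ` differ from it by elements near `1`, and `F(ℤ[1/3])` meets the open
congruence subgroup modulo `3` trivially. -/
theorem discreteTopology_range_toPGL : DiscreteTopology (toPGL ψ).range := by
  rw [discreteTopology_iff_isOpen_singleton]
  rintro ⟨_, σ, rfl⟩
  let U : Set PGL(2, ℚ_[3]) := {g | ∀ a b,
    ‖rot (pglAut ψ g * (padicAut σ)⁻¹) a b - (1 : Matrix (Fin 3) (Fin 3) ℚ_[3]) a b‖ < 1}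
  have hU : IsOpen U := by
    rw [isOpen_coinduced]
    have : Matrix.ProjGenLinGroup.mk ⁻¹' U = ⋂ a, ⋂ b, {A : GL (Fin 2) ℚ_[3] |
        ‖rot (pglAut ψ (Matrix.ProjGenLinGroup.mk A) * (padicAut σ)⁻¹) a b -
          (1 : Matrix (Fin 3) (Fin 3) ℚ_[3]) a b‖ < 1} := by
      ext A; simp [U]
    rw [this]
    refine isOpen_iInter_of_finite fun a => isOpen_iInter_of_finite fun b => ?_
    refine isOpen_lt (Continuous.norm (Continuous.sub ?_ continuous_const)) continuous_const
    simp only [map_mul, Matrix.mul_apply]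
    exact continuous_finsetSum _ fun c _ => (continuous_rot_pglAut ψ a c).mul continuous_const
  refine ⟨U, hU, ?_⟩
  ext ⟨_, τ, rfl⟩
  rw [Set.mem_preimage, Set.mem_singleton_iff, Subtype.ext_iff]
  constructor
  · intro h
    have h' : ∀ a b, ‖rot (padicAut (τ * σ⁻¹)) a b -
        (1 : Matrix (Fin 3) (Fin 3) ℚ_[3]) a b‖ < 1 := by
      simpa only [U, Set.mem_ofPred_eq, pglAut_toPGL, map_mul, map_inv] using h
    rw [mul_inv_eq_one.1 (eq_one_of_congr_one h')]
  · intro h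
    rw [h]
    change toPGL ψ σ ∈ U
    intro a b
    rw [pglAut_toPGL, mul_inv_cancel, map_one, sub_self, norm_zero]
    exact one_pos

/-- Cubing divides the distance to the identity by exactly `3` in the congruence subgroup. -/
theorem norm_cube_sub_one {M : Matrix (Fin 3) (Fin 3) ℚ_[3]} {s : ℝ} (hs0 : 0 < s) (hs : s ≤ 1 / 3)
    (hle : ∀ a b, ‖(M - 1) a b‖ ≤ s) {a₀ b₀ : Fin 3} (heq : ‖(M - 1) a₀ b₀‖ = s) :
    (∀ a b, ‖(M ^ 3 - 1 : Matrix (Fin 3) (Fin 3) ℚ_[3]) a b‖ ≤ s / 3) ∧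
      ‖(M ^ 3 - 1 : Matrix (Fin 3) (Fin 3) ℚ_[3]) a₀ b₀‖ = s / 3 := by
  obtain ⟨D, rfl⟩ : ∃ D, M = 1 + D := ⟨M - 1, by abel⟩
  rw [add_sub_cancel_left] at hle heq
  have h3 : ‖(3 : ℚ_[3])‖ = 1 / 3 := by
    have := Padic.norm_p (p := 3)
    rw [one_div]; exact_mod_cast this
  have hmul : ∀ (X Y : Matrix (Fin 3) (Fin 3) ℚ_[3]) (x y : ℝ), 0 ≤ x → 0 ≤ y →
      (∀ a b, ‖X a b‖ ≤ x) → (∀ a b, ‖Y a b‖ ≤ y) → ∀ a b, ‖(X * Y) a b‖ ≤ x * y := by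
    intro X Y x y hx hy hX hY a b
    rw [Matrix.mul_apply, Fin.sum_univ_three]
    have : ∀ c, ‖X a c * Y c b‖ ≤ x * y := fun c => by
      rw [norm_mul]
      exact mul_le_mul (hX a c) (hY c b) (norm_nonneg _) hx
    exact (Padic.nonarchimedean _ _).trans (max_le
      ((Padic.nonarchimedean _ _).trans (max_le (this 0) (this 1))) (this 2))
  have h2 := hmul D D s s hs0.le hs0.le hle hle
  have h4 := hmul (D * D) D (s * s) s (by positivity) hs0.le h2 hle
  have hexp : (1 + D) ^ 3 - 1 = 3 • D + (3 • (D * D) + D * D * D) := by noncomm_ring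
  have hentry : ∀ a b, ((1 + D) ^ 3 - 1 : Matrix (Fin 3) (Fin 3) ℚ_[3]) a b =
      3 * D a b + (3 * (D * D) a b + (D * D * D) a b) := fun a b => by
    rw [hexp, ← Nat.cast_smul_eq_nsmul ℚ_[3] 3 D, ← Nat.cast_smul_eq_nsmul ℚ_[3] 3 (D * D)]
    simp only [Matrix.add_apply, Matrix.smul_apply, smul_eq_mul, Nat.cast_ofNat]
  have hsmall : ∀ a b, ‖3 * (D * D) a b + (D * D * D) a b‖ < s / 3 := by
    intro a b
    refine (Padic.nonarchimedean _ _).trans_lt (max_lt ?_ ?_)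
    · rw [norm_mul, h3]
      nlinarith [h2 a b]
    · have hss : s * s ≤ s * (1 / 3) := mul_le_mul_of_nonneg_left hs hs0.le
      nlinarith [h4 a b, mul_le_mul hss hs hs0.le (by positivity)]
  have hbig : ∀ a b, ‖3 * D a b‖ ≤ s / 3 := fun a b => by
    rw [norm_mul, h3]; linarith [hle a b]
  constructor
  · intro a b
    rw [hentry]
    exact (Padic.nonarchimedean _ _).trans (max_le (hbig a b) (hsmall a b).le)
  · have hb : ‖3 * D a₀ b₀‖ = s / 3 := by rw [norm_mul, h3, heq]; ring
    rw [hentry, Padic.add_eq_max_of_ne (by rw [hb]; exact (hsmall a₀ b₀).ne'), hb,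
      max_eq_left (hsmall a₀ b₀).le]

theorem norm_pow_sub_one {M : Matrix (Fin 3) (Fin 3) ℚ_[3]} {s : ℝ} (hs0 : 0 < s) (hs : s ≤ 1 / 3)
    (hle : ∀ a b, ‖(M - 1) a b‖ ≤ s) {a₀ b₀ : Fin 3} (heq : ‖(M - 1) a₀ b₀‖ = s) (n : ℕ) :
    (∀ a b, ‖(M ^ 3 ^ n - 1 : Matrix (Fin 3) (Fin 3) ℚ_[3]) a b‖ ≤ s / 3 ^ n) ∧
      ‖(M ^ 3 ^ n - 1 : Matrix (Fin 3) (Fin 3) ℚ_[3]) a₀ b₀‖ = s / 3 ^ n := by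
  induction n with
  | zero => simpa using ⟨hle, heq⟩
  | succ n ih =>
    have h1 : s / 3 ^ n ≤ 1 / 3 :=
      (div_le_self hs0.le (one_le_pow₀ (by norm_num))).trans hs
    have := norm_cube_sub_one (by positivity) h1 ih.1 ih.2
    rwa [← pow_mul, ← pow_succ, div_div, ← pow_succ] at this

/-- A discrete subgroup of `PGL₂(ℚ₃)` meets the congruence subgroup modulo `3` trivially: the powers
`g ^ (3 ^ n)` of an element `g ≠ 1` of the intersection would be nontrivial and tend to `1`. -/
theorem eq_one_of_discrete {Γ : Subgroup PGL(2, ℚ_[3])} [DiscreteTopology Γ] {g : PGL(2, ℚ_[3])}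
    (hg : g ∈ Γ) (h : ∀ a b,
      ‖rot (pglAut ψ g) a b - (1 : Matrix (Fin 3) (Fin 3) ℚ_[3]) a b‖ < 1) : g = 1 := by
  by_contra hne
  obtain ⟨U, hU, hU1⟩ := (isOpen_discrete ({1} : Set Γ))
  have hUmem : ∀ x ∈ Γ, x ∈ U → x = 1 := by
    intro x hx hxU
    have : (⟨x, hx⟩ : Γ) ∈ ({1} : Set Γ) := by rw [← hU1]; exact hxU
    exact congrArg Subtype.val (Set.mem_singleton_iff.1 this)
  have h1U : (1 : PGL(2, ℚ_[3])) ∈ U := by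
    have : (1 : Γ) ∈ ((↑) : Γ → PGL(2, ℚ_[3])) ⁻¹' U := by rw [hU1]; rfl
    exact this
  set M := rot (pglAut ψ g) with hM
  obtain ⟨⟨a₀, b₀⟩, hmax⟩ := Finite.exists_max fun p : Fin 3 × Fin 3 => ‖(M - 1) p.1 p.2‖
  have hs : ‖(M - 1) a₀ b₀‖ ≤ 1 / 3 := by
    have h1 : ‖(M - 1) a₀ b₀‖ < ((3 : ℕ) : ℝ) ^ ((-1 : ℤ) + 1) := by simpa using h a₀ b₀
    rw [← Padic.norm_le_pow_iff_norm_lt_pow_add_one] at h1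
    simpa using h1
  have hs0 : 0 < ‖(M - 1) a₀ b₀‖ := by
    refine lt_of_le_of_ne (norm_nonneg _) fun h0 => hne ?_
    have hM1 : M = 1 := by
      rw [← sub_eq_zero]
      ext a b
      have := hmax (a, b)
      rw [← h0] at this
      simpa using this
    apply (pglAut ψ).injective
    apply rot_injective
    rw [← hM, hM1, map_one, map_one]
  have hpow := norm_pow_sub_one hs0 hs (fun a b => hmax (a, b)) rfl
  have hlim : Tendsto (fun n : ℕ => M ^ 3 ^ n) atTop (𝓝 1) := by
    refine tendsto_pi_nhds.2 fun a => tendsto_pi_nhds.2 fun b => ?_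
    rw [tendsto_iff_norm_sub_tendsto_zero]
    refine squeeze_zero (fun _ => norm_nonneg _) (fun n => (hpow n).1 a b) ?_
    have : Tendsto (fun n : ℕ => ‖(M - 1) a₀ b₀‖ * (1 / 3 : ℝ) ^ n) atTop (𝓝 0) := by
      simpa using (tendsto_pow_atTop_nhds_zero_of_lt_one (by norm_num : (0 : ℝ) ≤ 1 / 3)
        (by norm_num)).const_mul ‖(M - 1) a₀ b₀‖
    refine this.congr fun n => ?_
    rw [one_div, inv_pow, div_eq_mul_inv]
  -- The conjugating matrices, normalized so as to tend to `1`.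
  let f : Matrix (Fin 3) (Fin 3) ℚ_[3] → M₂ ℚ_[3] := fun X => (1 / 4 : ℚ_[3]) •
    (1 - ∑ b, (∑ a, X a b • splitting ψ (ofVec (Pi.single a 1))) *
      splitting ψ (ofVec (Pi.single b 1)))
  have hf : Continuous f := by
    have hX : ∀ a b, Continuous fun X : Matrix (Fin 3) (Fin 3) ℚ_[3] => X a b :=
      fun a b => continuous_id.matrix_elem a b
    simp only [f]
    fun_prop
  have hf1 : f 1 = 1 := by
    have h1 : f 1 = (1 / 4 : ℚ_[3]) • splitting ψ (intertwiner (1 : ℍ[ℚ_[3]] ≃ₐ[ℚ_[3]] _)) := by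
      rw [splitting_intertwiner, map_one]
    have h2 : intertwiner (1 : ℍ[ℚ_[3]] ≃ₐ[ℚ_[3]] _) = (4 : ℚ_[3]) • 1 := by
      rw [intertwiner, Fin.sum_univ_three]
      ext <;> simp
      norm_num
    rw [h1, h2, map_smul, map_one, smul_smul]
    norm_num
  have hlim' : Tendsto (fun n : ℕ => f (M ^ 3 ^ n)) atTop (𝓝 1) := by
    rw [← hf1]
    exact (hf.tendsto 1).comp hlim
  have hev := hlim'.eventually (eventually_exists_GL
    (V := Matrix.ProjGenLinGroup.mk ⁻¹' U) (isOpen_coinduced.1 hU) h1U)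
  obtain ⟨n, A, hAU, hA⟩ := hev.exists
  have hgA : Matrix.ProjGenLinGroup.mk A = g ^ 3 ^ n := by
    apply (pglAut ψ).injective
    rw [pglAut_eq_mk_iff]
    intro x
    have h1 : (A : M₂ ℚ_[3]) =
        (1 / 4 : ℚ_[3]) • splitting ψ (intertwiner (pglAut ψ (g ^ 3 ^ n))) := by
      rw [hA, splitting_intertwiner, map_pow, map_pow]
    rw [h1, mul_smul_comm, smul_mul_assoc, ← map_mul, ← map_mul, intertwiner_spec]
  have hone := hUmem _ (pow_mem hg (3 ^ n)) (hgA ▸ hAU)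
  have h0 := (hpow n).2
  have hM1 : M ^ 3 ^ n = 1 := by rw [hM, ← map_pow, ← map_pow, hone, map_one, map_one]
  rw [hM1, sub_self, Matrix.zero_apply, norm_zero] at h0
  have : 0 < ‖(M - 1) a₀ b₀‖ / 3 ^ n := by positivity
  exact this.ne h0

/-- The image of `F(ℤ[1/3])` is a maximal discrete subgroup of `PGL₂(ℚ₃)`: its product with
the congruence subgroup modulo `3`, which meets every discrete subgroup trivially, is the whole
group. -/
theorem maximal_range_toPGL :
    Maximal (fun Γ : Subgroup PGL(2, ℚ_[3]) => DiscreteTopology Γ) (toPGL ψ).range := by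
  refine ⟨discreteTopology_range_toPGL ψ, fun Γ hΓ hle g hg => ?_⟩
  have : DiscreteTopology Γ := hΓ
  obtain ⟨δ, _, h⟩ := exists_congr_one (pglAut ψ g)
  rw [← pglAut_toPGL ψ, ← map_mul] at h
  have h1 := eq_one_of_discrete ψ (mul_mem (hle ⟨δ, rfl⟩) hg) h
  rw [eq_inv_of_mul_eq_one_right h1]
  exact inv_mem ⟨δ, rfl⟩

end Maximal

/-! ### Splitting the Hurwitz quaternions -/

/-- If `a² + b² = -1`, then `i ↦ (0, 1; -1, 0)` and `j ↦ (a, b; b, -a)` split the quaternions. -/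
theorem nonempty_splitting {K : Type*} [Field K] [CharZero K] {a b : K} (hab : a ^ 2 + b ^ 2 = -1) :
    Nonempty (K ⊗[ℤ] Hurwitz ≃ₐ[K] M₂ K) := by
  let B : QuaternionAlgebra.Basis (M₂ K) (-1 : K) 0 (-1) :=
    { i := !![0, 1; -1, 0]
      j := !![a, b; b, -a]
      k := !![b, -a; -a, -b]
      i_mul_i := by ext i j; fin_cases i <;> fin_cases j <;> simp
      j_mul_j := by
        ext i j
        fin_cases i <;> fin_cases j <;> simp <;> first | ring1 | linear_combination hab
      i_mul_j := by ext i j; fin_cases i <;> fin_cases j <;> simp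
      j_mul_i := by ext i j; fin_cases i <;> fin_cases j <;> simp }
  let f : ℍ[K] →ₐ[K] M₂ K := B.liftHom
  have hf : ∀ q : ℍ[K], f q = !![q.re + q.imJ * a + q.imK * b, q.imI + q.imJ * b - q.imK * a;
      -q.imI + q.imJ * b - q.imK * a, q.re - q.imJ * a - q.imK * b] := by
    intro q
    have h1 : f q = algebraMap K (M₂ K) q.re + q.imI • B.i + q.imJ • B.j + q.imK • B.k := rfl
    rw [h1]
    ext i j
    fin_cases i <;> fin_cases j <;> simp [B, Matrix.algebraMap_matrix_apply] <;> ring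
  have hinj : Function.Injective f := by
    rw [injective_iff_map_eq_zero]
    intro q hq
    rw [hf] at hq
    have h00 := congrFun (congrFun hq 0) 0
    have h01 := congrFun (congrFun hq 0) 1
    have h10 := congrFun (congrFun hq 1) 0
    have h11 := congrFun (congrFun hq 1) 1
    simp at h00 h01 h10 h11
    ext
    · simp; linear_combination (h00 + h11) / 2
    · simp; linear_combination (h01 - h10) / 2
    · simp; linear_combination q.imJ * hab - a * (h00 - h11) / 2 - b * (h01 + h10) / 2
    · simp; linear_combination q.imK * hab - b * (h00 - h11) / 2 + a * (h01 + h10) / 2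
  have hsurj : Function.Surjective f := by
    refine (LinearMap.injective_iff_surjective_of_finrank_eq_finrank (f := f.toLinearMap) ?_).1 hinj
    rw [Quaternion.finrank_eq_four, Module.finrank_matrix]
    simp
  exact ⟨(hurwitzEquiv K).trans (AlgEquiv.ofBijective f ⟨hinj, hsurj⟩)⟩

theorem nonempty_splitting_of_isAlgClosed (k : Type*) [Field k] [IsAlgClosed k] [CharZero k] :
    Nonempty (k ⊗[ℤ] Hurwitz ≃ₐ[k] M₂ k) := by
  obtain ⟨a, ha⟩ := IsAlgClosed.exists_pow_nat_eq (-1 : k) (n := 2) (by norm_num)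
  exact nonempty_splitting (a := a) (b := 0) (by rw [ha]; ring)

/-- By Hensel's lemma `-2` is a square in `ℚ₃`, so that `-1` is a sum of two squares. -/
theorem nonempty_splitting_padic : Nonempty (ℚ_[3] ⊗[ℤ] Hurwitz ≃ₐ[ℚ_[3]] M₂ ℚ_[3]) := by
  obtain ⟨z, hz, -⟩ := hensels_lemma (p := 3) (R := ℤ_[3]) (a := 1)
    (F := Polynomial.X ^ 2 + Polynomial.C 2) (by
      have h2 : ‖(2 : ℤ_[3])‖ = 1 := by
        have := PadicInt.norm_intCast_eq_one_iff (p := 3) (z := 2)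
        exact_mod_cast this.2 (by decide)
      have h3 : ‖(3 : ℤ_[3])‖ < 1 := by
        have := PadicInt.norm_intCast_lt_one_iff (p := 3) (z := 3)
        exact_mod_cast this.2 (by decide)
      simp [Polynomial.aeval_def]
      norm_num [h2, h3])
  have hz' : z ^ 2 + 2 = 0 := by simpa using hz
  have hz2 : (z : ℚ_[3]) ^ 2 + 2 = 0 := by
    have := congrArg (fun x : ℤ_[3] => (x : ℚ_[3])) hz'
    push_cast at this
    exact this
  exact nonempty_splitting (a := 1) (b := (z : ℚ_[3])) (by linear_combination hz2)

/-! ### The Hessian quartic along lines through the vertices -/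

section Hessian
variable {k : Type*} [Field k]

theorem aeval_hessian {A : Type*} [CommRing A] [Algebra k A] (lam : Fin 5 → k) (Y : Fin 5 → A) :
    MvPolynomial.aeval Y (hessian lam) =
      ∑ a, ∏ b ∈ Finset.univ.erase a, algebraMap k A (lam b) * Y b := by
  simp [hessian, map_sum, map_prod]

/-- The fourth elementary symmetric function of five variables, two of which are singled out. -/
theorem sum_prod_erase {A : Type*} [CommRing A] (m : Fin 5 → A) {a b c d e : Fin 5}
    (h : [a, b, c, d, e].Nodup) : ∑ i, ∏ j ∈ Finset.univ.erase i, m j =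
      m a * m b * (m c * m d + m c * m e + m d * m e) + (m a + m b) * (m c * m d * m e) := by
  have hinj : Function.Injective ![a, b, c, d, e] := List.nodup_ofFn.1 (by simpa using h)
  let σ : Fin 5 ≃ Fin 5 := Equiv.ofBijective _ (Finite.injective_iff_bijective.1 hinj)
  have h1 : ∀ i, ∏ j ∈ Finset.univ.erase (σ i), m j = ∏ j ∈ Finset.univ.erase i, m (σ j) := by
    intro i
    refine (Finset.prod_equiv σ (fun j => ?_) (fun j _ => rfl)).symm
    simp
  rw [← Equiv.sum_comp σ]
  simp only [h1]
  have e0 : (Finset.univ.erase 0 : Finset (Fin 5)) = {1, 2, 3, 4} := by decide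
  have e1 : (Finset.univ.erase 1 : Finset (Fin 5)) = {0, 2, 3, 4} := by decide
  have e2 : (Finset.univ.erase 2 : Finset (Fin 5)) = {0, 1, 3, 4} := by decide
  have e3 : (Finset.univ.erase 3 : Finset (Fin 5)) = {0, 1, 2, 4} := by decide
  have e4 : (Finset.univ.erase 4 : Finset (Fin 5)) = {0, 1, 2, 3} := by decide
  have s0 : σ 0 = a := rfl
  have s1 : σ 1 = b := rfl
  have s2 : σ 2 = c := rfl
  have s3 : σ 3 = d := rfl
  have s4 : σ 4 = e := rfl
  rw [Fin.sum_univ_five, e0, e1, e2, e3, e4]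
  simp [s0, s1, s2, s3, s4]
  ring

/-- Projection from a vertex: on the line through `y` and `P_ab` the Hessian is a quadratic
polynomial. -/
theorem aeval_line {R : Type*} [CommRing R] [Algebra k R] (lam : Fin 5 → k) (y : Fin 5 → R)
    {a b c d e : Fin 5} (h : [a, b, c, d, e].Nodup) {m : Fin 5 → R}
    (hm : ∀ i, m i = algebraMap k R (lam i) * y i) {s₂ s₃ : R}
    (h2 : s₂ = m c * m d + m c * m e + m d * m e) (h3 : s₃ = m c * m d * m e) :
    MvPolynomial.aeval (fun i => Polynomial.C (y i) + Polynomial.X * Polynomial.C (vertex R a b i))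
        (hessian lam) =
      Polynomial.C (-(algebraMap k R (lam a) * algebraMap k R (lam b) * s₂)) * Polynomial.X ^ 2 +
      Polynomial.C (algebraMap k R (lam a) * algebraMap k R (lam b) * s₂ * (y b - y a) +
        (algebraMap k R (lam a) - algebraMap k R (lam b)) * s₃) * Polynomial.X +
      Polynomial.C (m a * m b * s₂ + (m a + m b) * s₃) := by
  have hv : ∀ i, i ≠ a → i ≠ b → vertex R a b i = 0 := fun i h1 h2 => by
    simp [vertex, h1, h2]
  rw [aeval_hessian, sum_prod_erase _ h]
  simp only [List.nodup_cons, List.mem_cons, List.not_mem_nil, or_false, not_or] at h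
  obtain ⟨⟨hab, hac, had, hae⟩, ⟨hbc, hbd, hbe⟩, ⟨hcd, hce⟩, hde, -⟩ := h
  have ha : vertex R a b a = 1 := by simp [vertex, hab]
  have hb : vertex R a b b = -1 := by simp [vertex, Ne.symm hab]
  rw [hv c (Ne.symm hac) (Ne.symm hbc), hv d (Ne.symm had) (Ne.symm hbd),
    hv e (Ne.symm hae) (Ne.symm hbe), ha, hb, h2, h3]
  simp only [hm, Polynomial.algebraMap_apply, map_neg, map_add, map_mul, map_sub, map_one, map_zero]
  ring

theorem ProjInvolution.symm {R : Type*} [CommRing R] [Algebra k R] {lam : Fin 5 → k} {a b : Fin 5}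
    {y y' : Fin 5 → R} (h : ProjInvolution lam a b y y') : ProjInvolution lam b a y y' := by
  have hv : vertex R b a = -vertex R a b := (neg_sub _ _).symm
  obtain ⟨c, r, hc, hy, hp⟩ := h
  refine ⟨c, -r, hc, by rw [hv, smul_neg, neg_smul, neg_neg, hy], ?_⟩
  let φ : Polynomial R →ₐ[k] Polynomial R :=
    (Polynomial.aeval (-Polynomial.X : Polynomial R)).restrictScalars k
  have hX : φ Polynomial.X = -Polynomial.X := Polynomial.aeval_X _
  have hC : ∀ s, φ (Polynomial.C s) = Polynomial.C s := fun s => Polynomial.aeval_C _ _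
  have h1 := congrArg φ hp
  rw [MvPolynomial.comp_aeval_apply] at h1
  simp only [map_add, map_mul, map_sub, hX, hC] at h1
  have h2 : (fun i => Polynomial.C (y i) + Polynomial.X * Polynomial.C (vertex R b a i)) =
      fun i => Polynomial.C (y i) + -Polynomial.X * Polynomial.C (vertex R a b i) := by
    funext i
    rw [hv, Pi.neg_apply, map_neg, mul_neg, neg_mul]
  rw [h2, h1, map_neg]
  ring

/-- If the Hessian on the line through the point `x + ε v` and `P_ab` has unit leading coefficient,
vanishing constant coefficient, and second root `ε ρ`, then the involution attached to `P_ab` is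
defined at `x + ε v` and maps it to `x + ε (v + ρ P_ab)`. -/
theorem projInvolution_nodePoint_iff {lam : Fin 5 → k} {a b : Fin 5} {v v' : hyperplane k}
    {c₂ c₁ c₀ : k[ε]} {ρ : k} (h : MvPolynomial.aeval (fun i => Polynomial.C (nodePoint v i) +
        Polynomial.X * Polynomial.C (vertex k[ε] a b i)) (hessian lam) =
      Polynomial.C c₂ * Polynomial.X ^ 2 + Polynomial.C c₁ * Polynomial.X + Polynomial.C c₀)
    (h2 : c₂.fst ≠ 0) (h1 : c₁ = -(c₂ * TrivSqZeroExt.inr ρ)) (h0 : c₀ = 0) :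
    ProjInvolution lam a b (nodePoint v) (nodePoint v') ↔
      (v' : Fin 5 → k) = (v : Fin 5 → k) + ρ • vertex k a b := by
  have hunit : IsUnit c₂ := TrivSqZeroExt.isUnit_iff_isUnit_fst.2 (isUnit_iff_ne_zero.2 h2)
  have hpt : nodePoint v' = nodePoint v + (TrivSqZeroExt.inr ρ : k[ε]) • vertex k[ε] a b ↔
      (v' : Fin 5 → k) = (v : Fin 5 → k) + ρ • vertex k a b := by
    rw [funext_iff, funext_iff]
    refine forall_congr' fun i => ?_
    have hv : vertex k[ε] a b i = TrivSqZeroExt.inl (vertex k a b i) := by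
      simp only [vertex, Pi.sub_apply, Pi.single_apply]
      split_ifs <;> simp
    rw [Pi.add_apply, Pi.smul_apply, hv, Pi.add_apply, Pi.smul_apply, TrivSqZeroExt.ext_iff]
    simp [nodePoint]
  rw [← hpt, ProjInvolution, h]
  constructor
  · rintro ⟨c, r, hc, hy, hp⟩
    have k2 := congrArg (fun p => Polynomial.coeff p 2) hp
    have k1 := congrArg (fun p => Polynomial.coeff p 1) hp
    have hexp : Polynomial.C c * Polynomial.X * (Polynomial.X - Polynomial.C r) =
        Polynomial.C c * Polynomial.X ^ 2 + Polynomial.C (-(c * r)) * Polynomial.X := by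
      simp only [map_neg, map_mul]; ring
    rw [hexp] at k1 k2
    simp [Polynomial.coeff_C] at k1 k2
    rw [← k2, h1, neg_inj] at k1
    rw [hunit.mul_left_cancel k1]
    exact hy
  · intro hy
    refine ⟨c₂, _, hunit, hy, ?_⟩
    rw [h1, h0]
    simp only [map_neg, map_mul, map_zero]
    ring

theorem param_of_ne {i : Fin 5} (hi : i ≠ 4) : param k i = 1 := by
  fin_cases i <;> simp_all [param]

theorem param_four : param k 4 = 1 / 16 := rfl

theorem node_of_ne {i : Fin 5} (hi : i ≠ 4) : (node k : Fin 5 → k) i = 1 := by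
  fin_cases i <;> simp_all [node]

theorem node_four : (node k : Fin 5 → k) 4 = -4 := rfl

theorem hyperplane_sum (v : hyperplane k) {a b c d e : Fin 5} (h : [a, b, c, d, e].Nodup) :
    (v : Fin 5 → k) a + (v : Fin 5 → k) b + (v : Fin 5 → k) c + (v : Fin 5 → k) d +
      (v : Fin 5 → k) e = 0 := by
  have hinj : Function.Injective ![a, b, c, d, e] := List.nodup_ofFn.1 (by simpa using h)
  have h1 : ∑ i, (v : Fin 5 → k) i = 0 := v.2
  rw [← Equiv.sum_comp (Equiv.ofBijective _ (Finite.injective_iff_bijective.1 hinj)),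
    Fin.sum_univ_five] at h1
  exact h1

variable [CharZero k]

/-- The involution of a vertex `P_ab` with `a, b ≠ 4` exchanges the coordinates `y_a` and `y_b`. -/
theorem projInvolution_iff_of_ne {a b c d : Fin 5} (h : [a, b, c, d, 4].Nodup)
    (v v' : hyperplane k) :
    ProjInvolution (param k) a b (nodePoint v) (nodePoint v') ↔
      (v' : Fin 5 → k) =
        (v : Fin 5 → k) + ((v : Fin 5 → k) b - (v : Fin 5 → k) a) • vertex k a b := by
  have hsum := hyperplane_sum v h
  have hline := aeval_line (param k) (nodePoint v) h (fun _ => rfl) rfl rfl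
  simp only [List.nodup_cons, List.mem_cons, List.not_mem_nil, or_false, not_or] at h
  obtain ⟨⟨hab, hac, had, ha4⟩, ⟨hbc, hbd, hb4⟩, ⟨hcd, hc4⟩, hd4, -⟩ := h
  simp only [param_of_ne ha4, param_of_ne hb4, param_of_ne hc4, param_of_ne hd4,
    param_four] at hline
  have hv4 : (v : Fin 5 → k) 4 = -((v : Fin 5 → k) a + (v : Fin 5 → k) b + (v : Fin 5 → k) c +
    (v : Fin 5 → k) d) := by linear_combination hsum
  refine projInvolution_nodePoint_iff hline ?_ ?_ ?_
  · simp [nodePoint, node_of_ne, hc4, hd4, node_four, TrivSqZeroExt.algebraMap_eq_inl]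
    norm_num
  · ext <;> simp [nodePoint, node_of_ne, ha4, hb4, hc4, hd4, node_four,
      TrivSqZeroExt.algebraMap_eq_inl]
    ring
  · ext <;> simp [nodePoint, node_of_ne, ha4, hb4, hc4, hd4, node_four, hv4,
      TrivSqZeroExt.algebraMap_eq_inl]
    · norm_num
    · ring

/-- The differential at the node of the involution of a vertex `P_a4`. The factor `v_a + v_4 / 4` is
the derivative along `v` of `y_a` on the affine chart `y_4 = -4`. -/
theorem projInvolution_iff_four {a b c d e : Fin 5} (h : [a, b, c, d, e].Nodup) (hb : b = 4)
    (v v' : hyperplane k) :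
    ProjInvolution (param k) a b (nodePoint v) (nodePoint v') ↔
      (v' : Fin 5 → k) = (v : Fin 5 → k) +
        (-(8 / 3) * ((v : Fin 5 → k) a + (v : Fin 5 → k) 4 / 4)) • vertex k a b := by
  subst hb
  have hsum := hyperplane_sum v h
  have hline := aeval_line (param k) (nodePoint v) h (fun _ => rfl) rfl rfl
  simp only [List.nodup_cons, List.mem_cons, List.not_mem_nil, or_false, not_or] at h
  obtain ⟨⟨hab, hac, had, ha4⟩, ⟨hbc, hbd, hb4⟩, ⟨hcd, hc4⟩, hd4, -⟩ := h
  have hv4 : (v : Fin 5 → k) 4 = -((v : Fin 5 → k) a + (v : Fin 5 → k) c +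
    (v : Fin 5 → k) d + (v : Fin 5 → k) e) := by linear_combination hsum
  simp only [param_of_ne hab, param_of_ne (Ne.symm hbc), param_of_ne (Ne.symm hbd),
    param_of_ne (Ne.symm hb4), param_four] at hline
  refine projInvolution_nodePoint_iff hline ?_ ?_ ?_
  · simp [nodePoint, node_of_ne, Ne.symm hbc, Ne.symm hbd, Ne.symm hb4,
      TrivSqZeroExt.algebraMap_eq_inl]
    norm_num
  · ext <;> simp [nodePoint, node_of_ne, hab, Ne.symm hbc, Ne.symm hbd, Ne.symm hb4, node_four, hv4,
      TrivSqZeroExt.algebraMap_eq_inl]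
    · norm_num
    · ring
  · ext <;> simp [nodePoint, node_of_ne, hab, Ne.symm hbc, Ne.symm hbd, Ne.symm hb4, node_four, hv4,
      TrivSqZeroExt.algebraMap_eq_inl]
    · norm_num
    · ring

end Hessian

/-! ### Coordinates on the tangent space at the node -/

/-- The four diagonals of the cube, which sum to zero, followed by `0`. -/
def cubeDiag : Fin 5 → Fin 3 → ℤ := ![![1, 1, 1], ![1, -1, -1], ![-1, 1, -1], ![-1, -1, 1], 0]

section Node
variable {k : Type*} [Field k]

/-- Coordinates on the tangent space at the node: the vector `¼ ∑ vₐ nₐ`, for the diagonals `nₐ` of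
the cube. -/
def nodeCoord : hyperplane k →ₗ[k] (Fin 3 → k) where
  toFun v := fun i => (1 / 4) * ∑ a, (v : Fin 5 → k) a * cubeDiag a i
  map_add' v w := by
    funext i
    simp only [Submodule.coe_add, Pi.add_apply, add_mul, Finset.sum_add_distrib, mul_add]
  map_smul' c v := by
    funext i
    simp only [Submodule.coe_smul, Pi.smul_apply, smul_eq_mul, RingHom.id_apply, mul_assoc,
      ← Finset.mul_sum]
    ring

/-- The vector in the hyperplane with coordinates `nₐ · x`. It is the representative with `v₄ = 0`
of the tangent vector with coordinates `x`. -/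
def nodeVec : (Fin 3 → k) →ₗ[k] hyperplane k where
  toFun x := ⟨fun a => ∑ i, cubeDiag a i * x i, by
    change ∑ a, ∑ i, (cubeDiag a i : k) * x i = 0
    simp [Fin.sum_univ_five, Fin.sum_univ_three, cubeDiag]; ring⟩
  map_add' x y := by
    apply Subtype.ext
    funext a
    simp only [Submodule.coe_add, Pi.add_apply, mul_add, Finset.sum_add_distrib]
  map_smul' c x := by
    apply Subtype.ext
    funext a
    simp only [Submodule.coe_smul, Pi.smul_apply, smul_eq_mul, RingHom.id_apply, Finset.mul_sum]
    exact Finset.sum_congr rfl fun i _ => by ring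

theorem nodeCoord_apply (v : hyperplane k) (i : Fin 3) :
    nodeCoord v i = (1 / 4) * ∑ a, (v : Fin 5 → k) a * cubeDiag a i := rfl

theorem nodeVec_apply (x : Fin 3 → k) (a : Fin 5) :
    (nodeVec x : Fin 5 → k) a = ∑ i, cubeDiag a i * x i := rfl

theorem hyperplane_four (v : hyperplane k) : (v : Fin 5 → k) 4 =
    -((v : Fin 5 → k) 0 + (v : Fin 5 → k) 1 + (v : Fin 5 → k) 2 + (v : Fin 5 → k) 3) := by
  linear_combination hyperplane_sum v (a := 0) (b := 1) (c := 2) (d := 3) (e := 4) (by decide)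

theorem nodeCoord_node : nodeCoord (node k) = 0 := by
  funext i
  simp only [nodeCoord_apply, Fin.sum_univ_five, cubeDiag, node]
  fin_cases i <;> simp

variable [CharZero k]

theorem nodeCoord_nodeVec (x : Fin 3 → k) : nodeCoord (nodeVec x) = x := by
  funext i
  simp only [nodeCoord_apply, nodeVec_apply, Fin.sum_univ_five, Fin.sum_univ_three, cubeDiag]
  fin_cases i <;> simp <;> ring

theorem nodeVec_nodeCoord (v : hyperplane k) :
    nodeVec (nodeCoord v) = v + ((v : Fin 5 → k) 4 / 4) • node k := by
  apply Subtype.ext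
  funext a
  rw [nodeVec_apply, Submodule.coe_add, Submodule.coe_smul, Pi.add_apply, Pi.smul_apply]
  simp only [nodeCoord_apply, Fin.sum_univ_five, Fin.sum_univ_three]
  rw [hyperplane_four]
  fin_cases a <;> simp [cubeDiag, node, hyperplane_four] <;> ring

theorem tangent_nodeVec_nodeCoord (v : hyperplane k) :
    tangent (nodeVec (nodeCoord v)) = tangent v := by
  rw [Submodule.Quotient.eq, nodeVec_nodeCoord, add_sub_cancel_left]
  exact Submodule.smul_mem _ _ (Submodule.mem_span_singleton_self _)

theorem tangent_eq_iff {v w : hyperplane k} :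
    tangent v = tangent w ↔ nodeCoord v = nodeCoord w := by
  constructor
  · intro h
    rw [Submodule.Quotient.eq, Submodule.mem_span_singleton] at h
    obtain ⟨c, hc⟩ := h
    rw [← sub_eq_zero, ← map_sub, ← hc, map_smul, nodeCoord_node, smul_zero]
  · intro h
    rw [← tangent_nodeVec_nodeCoord v, h, tangent_nodeVec_nodeCoord]

theorem tangent_eq_zero_iff {v : hyperplane k} : tangent v = 0 ↔ nodeCoord v = 0 := by
  have h : (0 : NodeTangent k) = tangent (0 : hyperplane k) := rfl
  rw [h, tangent_eq_iff, map_zero]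

theorem mk_tangent_eq_iff {v w : hyperplane k} (hv : tangent v ≠ 0) (hw : tangent w ≠ 0) :
    Projectivization.mk k (tangent v) hv = Projectivization.mk k (tangent w) hw ↔
      ∃ c : k, c • nodeCoord w = nodeCoord v := by
  rw [Projectivization.mk_eq_mk_iff']
  refine exists_congr fun c => ?_
  rw [← map_smul, ← tangent_eq_iff]
  rfl

/-- The tangent cone at the node is the quadric cone `x · x = 0`. -/
theorem coneForm_eq_zero_iff (v : hyperplane k) :
    coneForm v = 0 ↔ nodeCoord v ⬝ᵥ nodeCoord v = 0 := by
  have h4 : ∀ a b c d a' b' c' d' : k,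
      ((Polynomial.C a + Polynomial.X * Polynomial.C a') *
        (Polynomial.C b + Polynomial.X * Polynomial.C b') *
        (Polynomial.C c + Polynomial.X * Polynomial.C c') *
        (Polynomial.C d + Polynomial.X * Polynomial.C d')).coeff 2 =
      a * b * c' * d' + a * c * b' * d' + a * d * b' * c' + b * c * a' * d' + b * d * a' * c' +
        c * d * a' * b' := by
    intro a b c d a' b' c' d'
    have h : (Polynomial.C a + Polynomial.X * Polynomial.C a') *
        (Polynomial.C b + Polynomial.X * Polynomial.C b') *
        (Polynomial.C c + Polynomial.X * Polynomial.C c') *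
        (Polynomial.C d + Polynomial.X * Polynomial.C d') =
      Polynomial.C (a * b * c * d) +
      Polynomial.C (a * b * c * d' + a * b * d * c' + a * c * d * b' + b * c * d * a') *
        Polynomial.X +
      Polynomial.C (a * b * c' * d' + a * c * b' * d' + a * d * b' * c' + b * c * a' * d' +
        b * d * a' * c' + c * d * a' * b') * Polynomial.X ^ 2 +
      Polynomial.C (a * b' * c' * d' + b * a' * c' * d' + c * a' * b' * d' + d * a' * b' * c') *
        Polynomial.X ^ 3 + Polynomial.C (a' * b' * c' * d') * Polynomial.X ^ 4 := by
      simp only [map_add, map_mul]; ring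
    rw [h]
    simp only [Polynomial.coeff_add, Polynomial.coeff_C_mul, Polynomial.coeff_X_pow,
      Polynomial.coeff_C, Polynomial.coeff_X]
    simp
  have hcone : coneForm v = -(nodeCoord v ⬝ᵥ nodeCoord v) := by
    have key : ∀ p : Fin 5 → Polynomial k, MvPolynomial.aeval p (hessian (param k)) =
        p 0 * p 1 * p 2 * p 3 + Polynomial.C (1 / 16) * (p 0 * p 1 * p 2 * p 4) +
          Polynomial.C (1 / 16) * (p 0 * p 1 * p 3 * p 4) +
          Polynomial.C (1 / 16) * (p 0 * p 2 * p 3 * p 4) +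
          Polynomial.C (1 / 16) * (p 1 * p 2 * p 3 * p 4) := by
      intro p
      rw [aeval_hessian, sum_prod_erase _ (a := 0) (b := 1) (c := 2) (d := 3) (e := 4) (by decide)]
      simp [param]
      ring
    rw [coneForm, key]
    simp only [Polynomial.coeff_add, Polynomial.coeff_C_mul, h4]
    rw [hyperplane_four v]
    simp only [dotProduct, nodeCoord_apply, Fin.sum_univ_five, Fin.sum_univ_three,
      hyperplane_four v]
    simp [node, cubeDiag]
    ring
  rw [hcone]
  simp

end Node

/-! ### The parametrization of the conic by nilpotent matrices -/

section Nilpotent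
variable {K : Type*} [Field K]

/-- The quadratic map sending `u` to the nilpotent `2 × 2` matrix with kernel and image spanned
by `u`. -/
def nilpotentMatrix : QuadraticMap K (Fin 2 → K) (M₂ K) :=
  LinearMap.BilinMap.toQuadraticMap (LinearMap.mk₂ K
    (fun u w : Fin 2 → K => !![u 0 * w 1, -(u 0 * w 0); u 1 * w 1, -(u 1 * w 0)])
    (fun u u' w => by ext i j; fin_cases i <;> fin_cases j <;> simp <;> ring)
    (fun c u w => by ext i j; fin_cases i <;> fin_cases j <;> simp <;> ring)
    (fun u w w' => by ext i j; fin_cases i <;> fin_cases j <;> simp <;> ring)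
    (fun c u w => by ext i j; fin_cases i <;> fin_cases j <;> simp <;> ring))

theorem nilpotentMatrix_apply (u : Fin 2 → K) :
    nilpotentMatrix u = !![u 0 * u 1, -(u 0 * u 0); u 1 * u 1, -(u 1 * u 0)] := rfl

theorem nilpotentMatrix_mul_self (u : Fin 2 → K) : nilpotentMatrix u * nilpotentMatrix u = 0 := by
  rw [nilpotentMatrix_apply]
  ext i j
  fin_cases i <;> fin_cases j <;> simp [Matrix.mul_apply, Fin.sum_univ_two] <;> ring

theorem nilpotentMatrix_ne_zero {u : Fin 2 → K} (hu : u ≠ 0) : nilpotentMatrix u ≠ 0 := by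
  intro h
  rw [nilpotentMatrix_apply] at h
  have h01 := congrFun (congrFun h 0) 1
  have h10 := congrFun (congrFun h 1) 0
  simp at h01 h10
  apply hu
  funext i
  fin_cases i <;> assumption

/-- The parametrization by nilpotent matrices is equivariant up to the determinant. -/
theorem nilpotentMatrix_mulVec_mul (A : M₂ K) (u : Fin 2 → K) :
    nilpotentMatrix (A.mulVec u) * A = A.det • (A * nilpotentMatrix u) := by
  simp only [nilpotentMatrix_apply, Matrix.det_fin_two]
  ext i j
  fin_cases i <;> fin_cases j <;>
    simp [Matrix.mul_apply, Fin.sum_univ_two, Matrix.mulVec, dotProduct] <;> ring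

theorem exists_smul_nilpotentMatrix {X : M₂ K} (hX : X * X = 0) (hX0 : X ≠ 0) :
    ∃ (c : K) (u : Fin 2 → K), u ≠ 0 ∧ c • nilpotentMatrix u = X := by
  obtain ⟨a, b, c, d, rfl⟩ : ∃ a b c d, X = !![a, b; c, d] := ⟨_, _, _, _, Matrix.eta_fin_two X⟩
  have h00 := congrFun (congrFun hX 0) 0
  have h01 := congrFun (congrFun hX 0) 1
  have h10 := congrFun (congrFun hX 1) 0
  have h11 := congrFun (congrFun hX 1) 1
  simp at h00 h01 h10 h11
  have had : a + d = 0 := by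
    by_contra had
    have hb : b = 0 := by
      have : (a + d) * b = 0 := by linear_combination h01
      simpa [had] using this
    have hc : c = 0 := by
      have : (a + d) * c = 0 := by linear_combination h10
      simpa [had] using this
    have ha : a = 0 := by simpa [hb] using h00
    have hd : d = 0 := by simpa [hb] using h11
    exact had (by rw [ha, hd, add_zero])
  obtain rfl : d = -a := by linear_combination had
  by_cases hc : c = 0
  · have ha : a = 0 := by simpa [hc] using h00
    refine ⟨-b, ![1, 0], fun h => one_ne_zero (congrFun h 0), ?_⟩
    rw [nilpotentMatrix_apply]
    ext i j
    fin_cases i <;> fin_cases j <;> simp [ha, hc]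
  · refine ⟨c⁻¹, ![a, c], fun h => hc (congrFun h 1), ?_⟩
    rw [nilpotentMatrix_apply]
    ext i j
    fin_cases i <;> fin_cases j <;> simp <;> field_simp
    linear_combination -h00

theorem eq_of_smul_nilpotentMatrix {c : K} {u u' : Fin 2 → K} (hu : u ≠ 0) (hu' : u' ≠ 0)
    (h : c • nilpotentMatrix u = nilpotentMatrix u') :
    Projectivization.mk K u hu = Projectivization.mk K u' hu' := by
  simp only [nilpotentMatrix_apply] at h
  have h00 := congrFun (congrFun h 0) 0
  have h01 := congrFun (congrFun h 0) 1
  have h10 := congrFun (congrFun h 1) 0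
  simp at h00 h01 h10
  have hdet : u 0 * u' 1 - u 1 * u' 0 = 0 := by
    have : (u 0 * u' 1 - u 1 * u' 0) ^ 2 = 0 := by
      linear_combination -(u 0) ^ 2 * h10 + 2 * u 0 * u 1 * h00 - (u 1) ^ 2 * h01
    exact pow_eq_zero_iff (two_ne_zero) |>.1 this
  rw [Projectivization.mk_eq_mk_iff']
  by_cases h0 : u' 0 = 0
  · have h1 : u' 1 ≠ 0 := fun h1 => hu' (by funext i; fin_cases i <;> assumption)
    refine ⟨u 1 / u' 1, ?_⟩
    funext i
    fin_cases i <;> simp <;> field_simp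
    linear_combination -hdet
  · refine ⟨u 0 / u' 0, ?_⟩
    funext i
    fin_cases i <;> simp <;> field_simp
    linear_combination hdet

end Nilpotent

section Isotropic
variable {K : Type*} [Field K]

theorem ofVec_mul_self {w : Fin 3 → K} (hw : w ⬝ᵥ w = 0) : ofVec w * ofVec w = 0 := by
  have h : w 0 * w 0 + w 1 * w 1 + w 2 * w 2 = 0 := by
    rw [← hw, dotProduct, Fin.sum_univ_three]
  ext <;> simp
  · linear_combination -h
  · ring
  · ring
  · ring

theorem ofVec_injective : Function.Injective (ofVec : (Fin 3 → K) →ₗ[K] ℍ[K]) :=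
  Function.LeftInverse.injective imVec_ofVec

variable [CharZero K] (ψ : K ⊗[ℤ] Hurwitz ≃ₐ[K] M₂ K)

theorem re_eq_zero_of_mul_self {q : ℍ[K]} (hq : q * q = 0) : q.re = 0 := by
  by_contra h
  have h0 := congrArg (fun q => q.re) hq
  have h1 := congrArg (fun q => q.imI) hq
  have h2 := congrArg (fun q => q.imJ) hq
  have h3 := congrArg (fun q => q.imK) hq
  simp at h0 h1 h2 h3
  have e1 : q.imI = 0 := by
    have : (2 * q.re) * q.imI = 0 := by linear_combination h1
    simpa [h] using this
  have e2 : q.imJ = 0 := by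
    have : (2 * q.re) * q.imJ = 0 := by linear_combination h2
    simpa [h] using this
  have e3 : q.imK = 0 := by
    have : (2 * q.re) * q.imK = 0 := by linear_combination h3
    simpa [h] using this
  rw [e1, e2, e3] at h0
  exact h (by simpa using h0)

/-- The parametrization of the isotropic vectors by pairs `u`, up to scalars: the vector part of the
nilpotent quaternion corresponding to the nilpotent matrix of `u`. -/
def isotropicVec : QuadraticMap K (Fin 2 → K) (Fin 3 → K) :=
  (imVec ∘ₗ (splitting ψ).symm.toLinearMap).compQuadraticMap nilpotentMatrix

theorem ofVec_isotropicVec (u : Fin 2 → K) :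
    ofVec (isotropicVec ψ u) = (splitting ψ).symm (nilpotentMatrix u) := by
  have h : isotropicVec ψ u = imVec ((splitting ψ).symm (nilpotentMatrix u)) := rfl
  rw [h, ofVec_imVec]
  apply re_eq_zero_of_mul_self
  rw [← map_mul, nilpotentMatrix_mul_self, map_zero]

theorem isotropicVec_dotProduct (u : Fin 2 → K) : isotropicVec ψ u ⬝ᵥ isotropicVec ψ u = 0 := by
  rw [← neg_eq_zero, ← re_ofVec_mul_ofVec, ofVec_isotropicVec, ← map_mul, nilpotentMatrix_mul_self,
    map_zero]
  rfl

theorem isotropicVec_ne_zero {u : Fin 2 → K} (hu : u ≠ 0) : isotropicVec ψ u ≠ 0 := by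
  intro h
  have h1 := ofVec_isotropicVec ψ u
  rw [h, map_zero, eq_comm, map_eq_zero_iff _ (splitting ψ).symm.injective] at h1
  exact nilpotentMatrix_ne_zero hu h1

theorem exists_smul_isotropicVec {w : Fin 3 → K} (hw : w ⬝ᵥ w = 0) (hw0 : w ≠ 0) :
    ∃ (c : K) (u : Fin 2 → K), u ≠ 0 ∧ c • isotropicVec ψ u = w := by
  obtain ⟨c, u, hu, h⟩ := exists_smul_nilpotentMatrix (X := splitting ψ (ofVec w))
    (by rw [← map_mul, ofVec_mul_self hw, map_zero])
    (fun h => hw0 (ofVec_injective (by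
      rwa [map_eq_zero_iff _ (splitting ψ).injective, ← map_zero ofVec] at h)))
  refine ⟨c, u, hu, ofVec_injective ?_⟩
  rw [map_smul, ofVec_isotropicVec, ← map_smul, h, AlgEquiv.symm_apply_apply]

theorem eq_of_smul_isotropicVec {c : K} {u u' : Fin 2 → K} (hu : u ≠ 0) (hu' : u' ≠ 0)
    (h : c • isotropicVec ψ u = isotropicVec ψ u') :
    Projectivization.mk K u hu = Projectivization.mk K u' hu' := by
  refine eq_of_smul_nilpotentMatrix (c := c) hu hu' ((splitting ψ).symm.injective ?_)
  rw [map_smul, ← ofVec_isotropicVec, ← ofVec_isotropicVec, ← h, map_smul]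

/-- The action of a quaternion on the projective line corresponds to its action by conjugation on
isotropic vectors. -/
theorem ofVec_isotropicVec_mulVec_mul {A : M₂ K} {n : ℍ[K]} (hA : A = splitting ψ n)
    (u : Fin 2 → K) : ofVec (isotropicVec ψ (A.mulVec u)) * n =
      A.det • (n * ofVec (isotropicVec ψ u)) := by
  apply (splitting ψ).injective
  rw [map_mul, map_smul, map_mul, ofVec_isotropicVec, ofVec_isotropicVec, AlgEquiv.apply_symm_apply,
    AlgEquiv.apply_symm_apply, ← hA, nilpotentMatrix_mulVec_mul]

theorem tangent_isotropicVec_ne_zero {u : Fin 2 → K} (hu : u ≠ 0) :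
    tangent (nodeVec (isotropicVec ψ u)) ≠ 0 := by
  rw [Ne, tangent_eq_zero_iff, nodeCoord_nodeVec]
  exact isotropicVec_ne_zero ψ hu

/-- The point of the conic attached to `u`. -/
def conicPoint (u : Fin 2 → K) (hu : u ≠ 0) : conic K :=
  ⟨Projectivization.mk K (tangent (nodeVec (isotropicVec ψ u))) (tangent_isotropicVec_ne_zero ψ hu),
    _, tangent_isotropicVec_ne_zero ψ hu, rfl, by
    rw [coneForm_eq_zero_iff, nodeCoord_nodeVec, isotropicVec_dotProduct]⟩

theorem conicPoint_eq_mk_iff {u : Fin 2 → K} (hu : u ≠ 0) {v : hyperplane K} (hv : tangent v ≠ 0) :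
    (conicPoint ψ u hu : ℙ K (NodeTangent K)) = Projectivization.mk K (tangent v) hv ↔
      ∃ c : K, c • nodeCoord v = isotropicVec ψ u := by
  refine (mk_tangent_eq_iff (tangent_isotropicVec_ne_zero ψ hu) hv).trans ?_
  rw [nodeCoord_nodeVec]

theorem conicPoint_congr {u u' : Fin 2 → K} (hu : u ≠ 0) (hu' : u' ≠ 0)
    (h : Projectivization.mk K u hu = Projectivization.mk K u' hu') :
    conicPoint ψ u hu = conicPoint ψ u' hu' := by
  obtain ⟨c, rfl⟩ := (Projectivization.mk_eq_mk_iff' K _ _ hu hu').1 h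
  apply Subtype.ext
  refine (conicPoint_eq_mk_iff ψ hu (tangent_isotropicVec_ne_zero ψ hu')).2 ?_
  rw [nodeCoord_nodeVec]
  exact ⟨c * c, (QuadraticMap.map_smul _ _ _).symm⟩

theorem mk_eq_of_conicPoint_eq {u u' : Fin 2 → K} (hu : u ≠ 0) (hu' : u' ≠ 0)
    (h : conicPoint ψ u hu = conicPoint ψ u' hu') :
    Projectivization.mk K u hu = Projectivization.mk K u' hu' := by
  obtain ⟨c, hc⟩ := (conicPoint_eq_mk_iff ψ hu' (tangent_isotropicVec_ne_zero ψ hu)).1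
    (congrArg Subtype.val h.symm)
  rw [nodeCoord_nodeVec] at hc
  exact eq_of_smul_isotropicVec ψ hu hu' hc

theorem exists_conicPoint_eq (p : conic K) :
    ∃ (u : Fin 2 → K) (hu : u ≠ 0), conicPoint ψ u hu = p := by
  obtain ⟨p, v, hv, rfl, hcone⟩ := p
  rw [coneForm_eq_zero_iff] at hcone
  have hv0 : nodeCoord v ≠ 0 := fun h => hv (tangent_eq_zero_iff.2 h)
  obtain ⟨c, u, hu, h⟩ := exists_smul_isotropicVec ψ hcone hv0
  have hc : c ≠ 0 := by
    rintro rfl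
    exact hv0 (by rw [← h, zero_smul])
  refine ⟨u, hu, Subtype.ext ?_⟩
  rw [conicPoint_eq_mk_iff]
  exact ⟨c⁻¹, by rw [← h, smul_smul, inv_mul_cancel₀ hc, one_smul]⟩

/-- The parametrization of the conic by the projective line. -/
def conicEquiv : ℙ K (Fin 2 → K) ≃ conic K :=
  Equiv.ofBijective (fun p => conicPoint ψ p.rep p.rep_nonzero) (by
    constructor
    · intro p p' h
      have := mk_eq_of_conicPoint_eq ψ _ _ h
      rwa [Projectivization.mk_rep, Projectivization.mk_rep] at this
    · intro p
      obtain ⟨u, hu, rfl⟩ := exists_conicPoint_eq ψ p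
      exact ⟨Projectivization.mk K u hu, conicPoint_congr ψ _ _ (Projectivization.mk_rep _)⟩)

theorem conicEquiv_mk (u : Fin 2 → K) (hu : u ≠ 0) :
    conicEquiv ψ (Projectivization.mk K u hu) = conicPoint ψ u hu :=
  conicPoint_congr ψ _ _ (Projectivization.mk_rep _)

theorem isConicIso_conicEquiv : IsConicIso (conicEquiv ψ) := by
  refine ⟨((Submodule.span K {node K}).mkQ ∘ₗ nodeVec).compQuadraticMap (isotropicVec ψ),
    fun u hu => ?_⟩
  rw [conicEquiv_mk]
  exact ⟨tangent_isotropicVec_ne_zero ψ hu, rfl⟩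

end Isotropic

/-! ### The differentials of the projection involutions as half-turns -/

section Realizes
variable {k : Type*} [Field k]

/-- The reflection in the plane orthogonal to `m` is `w ↦ -m w m⁻¹`. -/
theorem ofVec_reflection_mul {m w : Fin 3 → k} {r : k} (hr : r * (m ⬝ᵥ m) = 2 * (m ⬝ᵥ w)) :
    ofVec (w - r • m) * ofVec m = -(ofVec m * ofVec w) := by
  simp only [dotProduct, Fin.sum_univ_three] at hr
  ext <;> simp
  · linear_combination hr
  · ring
  · ring
  · ring

/-- The vector `nₐ - n_b`. -/
def cubeDiff (k : Type*) [Field k] (a b : Fin 5) : Fin 3 → k :=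
  fun i => cubeDiag a i - cubeDiag b i

theorem cubeDiff_dotProduct (a b : Fin 5) (w : Fin 3 → k) : cubeDiff k a b ⬝ᵥ w =
    ∑ i, (cubeDiag a i : k) * w i - ∑ i, (cubeDiag b i : k) * w i := by
  rw [← Finset.sum_sub_distrib]
  exact Finset.sum_congr rfl fun i _ => sub_mul _ _ _

theorem cubeDiff_dotProduct_self {a b : Fin 5} {n : ℤ}
    (h : ∑ i, (cubeDiag a i - cubeDiag b i) * (cubeDiag a i - cubeDiag b i) = n) :
    cubeDiff k a b ⬝ᵥ cubeDiff k a b = n := by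
  rw [← h, dotProduct]
  push_cast
  rfl

variable [CharZero k]

/-- In the coordinates on the tangent space at the node, the differential of the involution of
`P_ab` is everywhere defined and equal to `x ↦ -h x h⁻¹`, for the pure quaternion `h`. -/
def Realizes (k : Type*) [Field k] [CharZero k] (a b : Fin 5) (h : Hurwitz) : Prop :=
  (∀ v : hyperplane k, ∃ v' : hyperplane k,
    ProjInvolution (param k) a b (nodePoint v) (nodePoint v')) ∧
  ∀ v v' : hyperplane k, ProjInvolution (param k) a b (nodePoint v) (nodePoint v') →
    ofVec (nodeCoord v') * quatCast k h = -(quatCast k h * ofVec (nodeCoord v))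

theorem Realizes.symm {a b : Fin 5} {h : Hurwitz} (H : Realizes k a b h) : Realizes k b a h :=
  ⟨fun v => (H.1 v).imp fun _ => ProjInvolution.symm, fun v v' hv => H.2 v v' hv.symm⟩

/-- If the involution of `P_ab` moves `v` by a multiple of `P_ab`, then in the coordinates at the
node it moves it by a multiple of `nₐ - n_b`; it is the reflection if the multiple is the right
one. -/
theorem realizes_of_projInvolution_iff {a b : Fin 5} {h : Hurwitz} {c : k}
    (hh : quatCast k h = c • ofVec (cubeDiff k a b)) (ρ : hyperplane k → k)
    (hρ : ∀ v v' : hyperplane k, ProjInvolution (param k) a b (nodePoint v) (nodePoint v') ↔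
      (v' : Fin 5 → k) = (v : Fin 5 → k) + ρ v • vertex k a b)
    (hr : ∀ v : hyperplane k, -(ρ v / 4) * (cubeDiff k a b ⬝ᵥ cubeDiff k a b) =
      2 * (cubeDiff k a b ⬝ᵥ nodeCoord v)) : Realizes k a b h := by
  have hvert : vertex k a b ∈ hyperplane k := by
    change ∑ i, vertex k a b i = 0
    simp [vertex, Finset.sum_sub_distrib]
  refine ⟨fun v => ⟨v + ρ v • ⟨vertex k a b, hvert⟩, (hρ _ _).2 rfl⟩, fun v v' hv => ?_⟩
  obtain rfl : v' = v + ρ v • ⟨vertex k a b, hvert⟩ := Subtype.ext ((hρ _ _).1 hv)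
  have hcoord : nodeCoord ⟨vertex k a b, hvert⟩ = (1 / 4 : k) • cubeDiff k a b := by
    funext i
    rw [nodeCoord_apply]
    simp [vertex, cubeDiff, Pi.single_apply, sub_mul, Finset.sum_sub_distrib]
  have hv' : nodeCoord (v + ρ v • ⟨vertex k a b, hvert⟩) =
      nodeCoord v - -(ρ v / 4) • cubeDiff k a b := by
    rw [map_add, map_smul, hcoord, smul_smul]
    module
  rw [hv', hh, mul_smul_comm, ofVec_reflection_mul (hr v), smul_mul_assoc, smul_neg]

theorem cubeDiag_dotProduct_nodeCoord (a : Fin 5) (ha : a ≠ 4) (v : hyperplane k) :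
    ∑ i, (cubeDiag a i : k) * nodeCoord v i = (v : Fin 5 → k) a + (v : Fin 5 → k) 4 / 4 := by
  rw [← nodeVec_apply, nodeVec_nodeCoord, Submodule.coe_add, Submodule.coe_smul, Pi.add_apply,
    Pi.smul_apply, node_of_ne ha, smul_eq_mul, mul_one]

theorem realizes_four {a : Fin 5} (ha : a ≠ 4) {h : Hurwitz} {c : k}
    (hh : quatCast k h = c • ofVec (cubeDiff k a 4)) : Realizes k a 4 h := by
  obtain ⟨c', d, e, hnodup⟩ : ∃ c d e, [a, 4, c, d, e].Nodup := by
    clear hh; revert a; decide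
  refine realizes_of_projInvolution_iff hh _ (projInvolution_iff_four hnodup rfl) fun v => ?_
  rw [cubeDiff_dotProduct_self (n := 3) (by clear hh hnodup; revert a; decide), cubeDiff_dotProduct,
    cubeDiag_dotProduct_nodeCoord a ha]
  simp [cubeDiag]
  ring

theorem realizes_of_ne {a b : Fin 5} (ha : a ≠ 4) (hb : b ≠ 4) (hab : a ≠ b) {h : Hurwitz} {c : k}
    (hh : quatCast k h = c • ofVec (cubeDiff k a b)) : Realizes k a b h := by
  obtain ⟨c', d, hnodup⟩ : ∃ c d, [a, b, c, d, 4].Nodup := by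
    clear hh; revert a b; decide
  refine realizes_of_projInvolution_iff hh _ (projInvolution_iff_of_ne hnodup) fun v => ?_
  rw [cubeDiff_dotProduct_self (n := 8) (by clear hh hnodup; revert a b; decide),
    cubeDiff_dotProduct, cubeDiag_dotProduct_nodeCoord a ha, cubeDiag_dotProduct_nodeCoord b hb]
  push_cast
  ring

variable (k)

theorem exists_realizes_diagonal {a : Fin 5} (ha : a ≠ 4) : ∃ h ∈ diagonals, Realizes k a 4 h := by
  refine ⟨hur 0 (cubeDiag a 0) (cubeDiag a 1) (cubeDiag a 2) 0,
    ⟨cubeDiag a 0, cubeDiag a 1, cubeDiag a 2, ?_, ?_, ?_, ?_⟩, realizes_four (c := 1) ha ?_⟩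
  · fin_cases a <;> simp_all [cubeDiag]
  · fin_cases a <;> simp_all [cubeDiag]
  · fin_cases a <;> simp_all [cubeDiag]
  · simp [hur]
  · ext <;> simp [hur, cubeDiff, cubeDiag]

theorem exists_realizes_of_mem_diagonals {h : Hurwitz} (hh : h ∈ diagonals) :
    ∃ a : Fin 5, a ≠ 4 ∧ Realizes k a 4 h := by
  have key : ∃ a : Fin 5, a ≠ 4 ∧ ∃ c : ℚ, (h : ℍ[ℚ]) =
      quat 0 (c * cubeDiag a 0) (c * cubeDiag a 1) (c * cubeDiag a 2) := by
    obtain ⟨r, s, t, hr, hs, ht, H⟩ := hh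
    rw [H]
    rcases hr with rfl | rfl <;> rcases hs with rfl | rfl <;> rcases ht with rfl | rfl
    · exact ⟨0, by decide, 1, by simp [cubeDiag]⟩
    · exact ⟨3, by decide, -1, by simp [cubeDiag]⟩
    · exact ⟨2, by decide, -1, by simp [cubeDiag]⟩
    · exact ⟨1, by decide, 1, by simp [cubeDiag]⟩
    · exact ⟨1, by decide, -1, by simp [cubeDiag]⟩
    · exact ⟨2, by decide, 1, by simp [cubeDiag]⟩
    · exact ⟨3, by decide, 1, by simp [cubeDiag]⟩
    · exact ⟨0, by decide, -1, by simp [cubeDiag]⟩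
  obtain ⟨a, ha, c, H⟩ := key
  refine ⟨a, ha, realizes_four (c := (c : k)) ha ?_⟩
  rw [H]
  ext <;> simp [cubeDiff, cubeDiag]

theorem exists_realizes_of_mem_midpoints {h : Hurwitz} (hh : h ∈ midpoints) :
    ∃ a b : Fin 5, a ≠ 4 ∧ b ≠ 4 ∧ a ≠ b ∧ Realizes k a b h := by
  have key : ∃ a b : Fin 5, a ≠ 4 ∧ b ≠ 4 ∧ a ≠ b ∧ ∃ c : ℚ, (h : ℍ[ℚ]) =
      quat 0 (c * (cubeDiag a 0 - cubeDiag b 0)) (c * (cubeDiag a 1 - cubeDiag b 1))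
        (c * (cubeDiag a 2 - cubeDiag b 2)) := by
    obtain ⟨r, s, hr, hs, H⟩ := hh
    rcases H with H | H | H <;> rw [H] <;> rcases hr with rfl | rfl <;> rcases hs with rfl | rfl
    · exact ⟨0, 3, by decide, by decide, by decide, 1 / 2, by simp [cubeDiag]; norm_num⟩
    · exact ⟨1, 2, by decide, by decide, by decide, 1 / 2, by simp [cubeDiag]; norm_num⟩
    · exact ⟨2, 1, by decide, by decide, by decide, 1 / 2, by simp [cubeDiag]; norm_num⟩
    · exact ⟨3, 0, by decide, by decide, by decide, 1 / 2, by simp [cubeDiag]; norm_num⟩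
    · exact ⟨0, 1, by decide, by decide, by decide, 1 / 2, by simp [cubeDiag]; norm_num⟩
    · exact ⟨2, 3, by decide, by decide, by decide, 1 / 2, by simp [cubeDiag]; norm_num⟩
    · exact ⟨3, 2, by decide, by decide, by decide, 1 / 2, by simp [cubeDiag]; norm_num⟩
    · exact ⟨1, 0, by decide, by decide, by decide, 1 / 2, by simp [cubeDiag]; norm_num⟩
    · exact ⟨0, 2, by decide, by decide, by decide, 1 / 2, by simp [cubeDiag]; norm_num⟩
    · exact ⟨3, 1, by decide, by decide, by decide, 1 / 2, by simp [cubeDiag]; norm_num⟩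
    · exact ⟨1, 3, by decide, by decide, by decide, 1 / 2, by simp [cubeDiag]; norm_num⟩
    · exact ⟨2, 0, by decide, by decide, by decide, 1 / 2, by simp [cubeDiag]; norm_num⟩
  obtain ⟨a, b, ha, hb, hab, c, H⟩ := key
  refine ⟨a, b, ha, hb, hab, realizes_of_ne (c := (c : k)) ha hb hab ?_⟩
  rw [H]
  ext <;> simp [cubeDiff]

theorem exists_realizes_midpoint {a b : Fin 5} (ha : a ≠ 4) (hb : b ≠ 4) (hab : a ≠ b) :
    ∃ h ∈ midpoints, Realizes k a b h := by
  have key : ∃ x y z : ℤ, (∀ i, 2 * ![x, y, z] i = cubeDiag a i - cubeDiag b i) ∧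
      (((x = 1 ∨ x = -1) ∧ (y = 1 ∨ y = -1) ∧ z = 0) ∨
      (x = 0 ∧ (y = 1 ∨ y = -1) ∧ (z = 1 ∨ z = -1)) ∨
      ((x = 1 ∨ x = -1) ∧ y = 0 ∧ (z = 1 ∨ z = -1))) := by
    refine ⟨(cubeDiag a 0 - cubeDiag b 0) / 2, (cubeDiag a 1 - cubeDiag b 1) / 2,
      (cubeDiag a 2 - cubeDiag b 2) / 2, ?_⟩
    revert a b
    decide
  obtain ⟨x, y, z, hxyz, hmem⟩ := key
  have cast : ∀ {x : ℤ}, (x = 1 ∨ x = -1) → ((x : ℚ) = 1 ∨ (x : ℚ) = -1) := fun h =>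
    h.imp (fun h => by rw [h]; simp) (fun h => by rw [h]; simp)
  refine ⟨hur 0 x y z 0, ?_, realizes_of_ne (c := 1 / 2) ha hb hab ?_⟩
  · rcases hmem with ⟨hx, hy, hz⟩ | ⟨hx, hy, hz⟩ | ⟨hx, hy, hz⟩
    · exact ⟨x, y, cast hx, cast hy, Or.inl (by simp [hur, hz])⟩
    · exact ⟨y, z, cast hy, cast hz, Or.inr (Or.inl (by simp [hur, hx]))⟩
    · exact ⟨z, x, cast hz, cast hx, Or.inr (Or.inr (by simp [hur, hy]))⟩
  · have hc : ∀ i, cubeDiff k a b i = 2 * ((![x, y, z] i : ℤ) : k) := fun i => by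
      rw [cubeDiff, ← Int.cast_sub, ← hxyz]
      push_cast
      rfl
    ext <;> simp [hur, hc]

theorem exists_realizes {a b : Fin 5} (hab : a ≠ b) :
    ∃ h ∈ diagonals ∪ midpoints, Realizes k a b h := by
  by_cases hb : b = 4
  · subst hb
    obtain ⟨h, hh, H⟩ := exists_realizes_diagonal k hab
    exact ⟨h, Or.inl hh, H⟩
  by_cases ha : a = 4
  · subst ha
    obtain ⟨h, hh, H⟩ := exists_realizes_diagonal k hb
    exact ⟨h, Or.inl hh, H.symm⟩
  · obtain ⟨h, hh, H⟩ := exists_realizes_midpoint k ha hb hab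
    exact ⟨h, Or.inr hh, H⟩

theorem exists_realizes_of_mem {h : Hurwitz} (hh : h ∈ diagonals ∪ midpoints) :
    ∃ a b : Fin 5, a ≠ b ∧ Realizes k a b h := by
  rcases hh with hh | hh
  · obtain ⟨a, ha, H⟩ := exists_realizes_of_mem_diagonals k hh
    exact ⟨a, 4, ha, H⟩
  · obtain ⟨a, b, -, -, hab, H⟩ := exists_realizes_of_mem_midpoints k hh
    exact ⟨a, b, hab, H⟩

end Realizes

/-! ### The induced transformations of the conic -/

section Induced
variable {k : Type*} [Field k] [CharZero k] (ψ : k ⊗[ℤ] Hurwitz ≃ₐ[k] M₂ k)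

theorem splitting_quatCast (h : Hurwitz) : splitting ψ (quatCast k h) = ψ (1 ⊗ₜ h) := by
  rw [← hurwitzEquiv_one_tmul, splitting, AlgEquiv.trans_apply, AlgEquiv.symm_apply_apply]

theorem exists_GL {h : Hurwitz} (hh : h ∈ diagonals ∪ midpoints) :
    ∃ A : GL (Fin 2) k, (A : M₂ k) = ψ (1 ⊗ₜ h) := by
  obtain ⟨n, hn, hsq⟩ : ∃ n : ℤ, n ≠ 0 ∧ h * h = n := by
    rcases hh with hh | hh
    · exact ⟨-3, by norm_num, by rw [diagonals_mul_self hh]; norm_num⟩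
    · exact ⟨-2, by norm_num, by rw [midpoints_mul_self hh]; norm_num⟩
  have h1 : ψ (1 ⊗ₜ h) * ψ (1 ⊗ₜ h) = (n : M₂ k) := by
    rw [← splitting_quatCast, ← map_mul, ← map_mul, ← Subring.coe_mul, hsq]
    simp
  have hu : IsUnit (n : M₂ k) := by
    rw [← map_intCast (algebraMap k (M₂ k))]
    exact (isUnit_iff_ne_zero.2 (Int.cast_ne_zero.2 hn)).map _
  rw [← h1] at hu
  have hu' : IsUnit (ψ (1 ⊗ₜ h)) := (Commute.refl (ψ (1 ⊗ₜ h))).isUnit_mul_iff.1 hu |>.1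
  exact ⟨hu'.unit, rfl⟩

variable {ψ} {h : Hurwitz} {A : GL (Fin 2) k} (hA : (A : M₂ k) = ψ (1 ⊗ₜ h))
include hA

/-- The action on the conic of a projection involution is the action of the corresponding quaternion
on the projective line. -/
theorem glPerm_conicPoint {a b : Fin 5} (H : Realizes k a b h) {u : Fin 2 → k} (hu : u ≠ 0)
    {v v' : hyperplane k} (hv : tangent v ≠ 0)
    (huv : (conicPoint ψ u hu : ℙ k (NodeTangent k)) = Projectivization.mk k (tangent v) hv)
    (hvv' : ProjInvolution (param k) a b (nodePoint v) (nodePoint v')) :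
    ∃ hv' : tangent v' ≠ 0,
      (conicEquiv ψ (glPerm k A (Projectivization.mk k u hu)) : ℙ k (NodeTangent k)) =
        Projectivization.mk k (tangent v') hv' := by
  have hA' : (A : M₂ k) = splitting ψ (quatCast k h) := by rw [hA, splitting_quatCast]
  have hunit : IsUnit (quatCast k h) := by
    have := A.isUnit.map (splitting ψ).symm
    rwa [hA', AlgEquiv.symm_apply_apply] at this
  have heq := H.2 v v' hvv'
  have hv' : tangent v' ≠ 0 := by
    intro h0
    rw [tangent_eq_zero_iff.1 h0, map_zero, zero_mul, eq_comm, neg_eq_zero, hunit.mul_right_eq_zero,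
      ← map_zero ofVec] at heq
    exact hv (tangent_eq_zero_iff.2 (ofVec_injective heq))
  have hAu : (A : M₂ k).mulVec u ≠ 0 := by
    intro h0
    apply hu
    have := congrArg ((A⁻¹ : GL (Fin 2) k) : M₂ k).mulVec h0
    rwa [Matrix.mulVec_mulVec, Units.inv_mul, Matrix.one_mulVec, Matrix.mulVec_zero] at this
  refine ⟨hv', ?_⟩
  obtain ⟨c, hc⟩ := (conicPoint_eq_mk_iff ψ hu hv).1 huv
  rw [glPerm_mk A u hu hAu, conicEquiv_mk, conicPoint_eq_mk_iff]
  refine ⟨-((A : M₂ k).det * c), ofVec_injective (hunit.mul_right_cancel ?_)⟩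
  rw [ofVec_isotropicVec_mulVec_mul ψ hA', ← hc, map_smul, map_smul, smul_mul_assoc, heq,
    mul_smul_comm, smul_smul, smul_neg, neg_smul, neg_neg]

theorem isInduced_iff {a b : Fin 5} (H : Realizes k a b h) (g : Equiv.Perm (conic k)) :
    IsInduced a b g ↔ g = (conicEquiv ψ).permCongr (glPerm k A) := by
  constructor
  · intro hg
    apply Equiv.ext
    intro p
    obtain ⟨u, hu, rfl⟩ := exists_conicPoint_eq ψ p
    obtain ⟨v', hv', hvv', hgp⟩ := hg (conicPoint ψ u hu) _ (tangent_isotropicVec_ne_zero ψ hu) rfl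
    obtain ⟨_, h2⟩ := glPerm_conicPoint hA H hu _ rfl hvv'
    apply Subtype.ext
    rw [hgp, Equiv.permCongr_apply, ← conicEquiv_mk, Equiv.symm_apply_apply, h2]
  · rintro rfl p v hv hpv
    obtain ⟨u, hu, rfl⟩ := exists_conicPoint_eq ψ p
    obtain ⟨v', hvv'⟩ := H.1 v
    obtain ⟨hv', h2⟩ := glPerm_conicPoint hA H hu hv hpv hvv'
    refine ⟨v', hv', hvv', ?_⟩
    rw [Equiv.permCongr_apply, ← conicEquiv_mk, Equiv.symm_apply_apply, h2]

end Induced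

section Images
variable {k : Type*} [Field k] [CharZero k] (ψ : k ⊗[ℤ] Hurwitz ≃ₐ[k] M₂ k)

theorem existsUnique_isInduced (ψ : k ⊗[ℤ] Hurwitz ≃ₐ[k] M₂ k) {a b : Fin 5} (hab : a ≠ b) :
    ∃! g : Equiv.Perm (conic k), IsInduced a b g := by
  obtain ⟨h, hh, H⟩ := exists_realizes k hab
  obtain ⟨A, hA⟩ := exists_GL ψ hh
  simp only [isInduced_iff hA H]
  exact existsUnique_eq

/-- If a set of pairs `a, b` and a set of quaternions correspond to each other, then so do the
transformations of the conic and of the projective line. -/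
theorem image_isInduced {S : Fin 5 → Fin 5 → Prop} {Q : Set Hurwitz}
    (hQ : Q ⊆ diagonals ∪ midpoints)
    (hS : ∀ a b, S a b → ∃ h ∈ Q, Realizes k a b h)
    (hQS : ∀ h ∈ Q, ∃ a b, S a b ∧ Realizes k a b h) :
    (conicEquiv ψ).symm.permCongr '' {g | ∃ a b, S a b ∧ IsInduced a b g} = quatPerms ψ Q := by
  have hinv : ∀ g, (conicEquiv ψ).symm.permCongr ((conicEquiv ψ).permCongr g) = g := fun g => by
    ext x; simp [Equiv.permCongr_apply]
  apply Set.Subset.antisymm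
  · rintro _ ⟨g, ⟨a, b, hab, hg⟩, rfl⟩
    obtain ⟨h, hh, H⟩ := hS a b hab
    obtain ⟨A, hA⟩ := exists_GL ψ (hQ hh)
    refine ⟨h, hh, A, hA, ?_⟩
    rw [(isInduced_iff hA H g).1 hg, hinv]
  · rintro _ ⟨h, hh, A, hA, rfl⟩
    obtain ⟨a, b, hab, H⟩ := hQS h hh
    exact ⟨_, ⟨a, b, hab, (isInduced_iff hA H _).2 rfl⟩, hinv _⟩

end Images

/-! ### The group generated by the induced transformations -/

section ProjectiveAction
variable {K : Type*} [Field K]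

/-- A matrix fixing the points `(1 : 0)`, `(0 : 1)` and `(1 : 1)` is scalar. -/
theorem pglPerm_injective : Function.Injective (pglPerm K) := by
  rw [injective_iff_map_eq_one]
  intro g hg
  induction g using Matrix.ProjGenLinGroup.induction_on with
  | mk A =>
    have key : ∀ u : Fin 2 → K, u ≠ 0 → ∃ c : K, c • u = (A : M₂ K).mulVec u := by
      intro u hu
      have hAu : (A : M₂ K).mulVec u ≠ 0 := by
        intro h0
        apply hu
        have := congrArg ((A⁻¹ : GL (Fin 2) K) : M₂ K).mulVec h0
        rwa [Matrix.mulVec_mulVec, Units.inv_mul, Matrix.one_mulVec, Matrix.mulVec_zero] at this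
      have h : glPerm K A (Projectivization.mk K u hu) = Projectivization.mk K u hu :=
        congrArg (fun g => g (Projectivization.mk K u hu)) hg
      rw [glPerm_mk A u hu hAu] at h
      exact (Projectivization.mk_eq_mk_iff' K _ _ hAu hu).1 h
    obtain ⟨a, b, c, d, hA⟩ : ∃ a b c d, (A : M₂ K) = !![a, b; c, d] :=
      ⟨_, _, _, _, Matrix.eta_fin_two _⟩
    rw [hA] at key
    obtain ⟨r, hr⟩ := key ![1, 0] (fun h => one_ne_zero (congrFun h 0))
    obtain ⟨s, hs⟩ := key ![0, 1] (fun h => one_ne_zero (congrFun h 1))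
    obtain ⟨t, ht⟩ := key ![1, 1] (fun h => one_ne_zero (congrFun h 0))
    have hc := congrFun hr 1
    have hb := congrFun hs 0
    have ht0 := congrFun ht 0
    have ht1 := congrFun ht 1
    simp [Matrix.mulVec, dotProduct, Fin.sum_univ_two] at hc hb ht0 ht1
    subst hc hb
    have had : d = a := by linear_combination ht0 - ht1
    rw [Matrix.ProjGenLinGroup.mk_eq_one, Subgroup.mem_center_iff]
    intro B
    apply Units.ext
    rw [Units.val_mul, Units.val_mul, hA, had, Matrix.eta_fin_two (B : M₂ K)]
    ext i j
    fin_cases i <;> fin_cases j <;> simp [mul_comm]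

end ProjectiveAction

section Group
variable {k : Type*} [Field k] [CharZero k] (ψ : k ⊗[ℤ] Hurwitz ≃ₐ[k] M₂ k)

/-- The conjugation by `h` is sent to the class of the matrix of `h`. -/
theorem toPGL_conj {h : Hurwitz} {A : GL (Fin 2) k} (hA : (A : M₂ k) = ψ (1 ⊗ₜ h)) {c : F ZThird}
    (hc : ConjugatesBy c h) :
    toPGL ψ c = Matrix.ProjGenLinGroup.mk A := by
  apply (pglAut ψ).injective
  rw [eq_comm, pglAut_eq_mk_iff]
  intro x
  obtain ⟨y, rfl⟩ := (hurwitzEquiv k).surjective x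
  have h1 : pglAut ψ (toPGL ψ c) (hurwitzEquiv k y) =
      hurwitzEquiv k (F.map (ZThird.toField k) c y) := by
    rw [toPGL_apply, pglAut, MulEquiv.trans_apply, MulEquiv.symm_apply_apply]
    simp
  rw [h1, splitting, AlgEquiv.trans_apply, AlgEquiv.trans_apply, AlgEquiv.symm_apply_apply,
    AlgEquiv.symm_apply_apply, hA, ← map_mul, ← map_mul, F.map_conj _ _ _ hc]

/-- The action of `F(ℤ[1/3])` on the projective line. -/
def projAction : F ZThird →* Equiv.Perm (ℙ k (Fin 2 → k)) := (pglPerm k).comp (toPGL ψ)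

theorem projAction_injective : Function.Injective (projAction ψ) :=
  pglPerm_injective.comp (toPGL_injective ψ)

theorem image_projAction :
    projAction ψ '' hurwitzConjugations ZThird = quatPerms ψ (diagonals ∪ midpoints) := by
  have key : ∀ (h : Hurwitz) (A : GL (Fin 2) k), (A : M₂ k) = ψ (1 ⊗ₜ h) → ∀ c : F ZThird,
      ConjugatesBy c h → projAction ψ c = glPerm k A := by
    intro h A hA c hc
    rw [projAction, MonoidHom.comp_apply, toPGL_conj ψ hA hc]
    rfl
  apply Set.Subset.antisymm
  · rintro _ ⟨c, ⟨h, hh, hc⟩, rfl⟩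
    obtain ⟨A, hA⟩ := exists_GL ψ hh
    exact ⟨h, hh, A, hA, key h A hA c hc⟩
  · rintro _ ⟨h, hh, A, hA, rfl⟩
    obtain ⟨c, hc⟩ := exists_conj ZThird.isUnit_three hh
    exact ⟨c, ⟨h, hh, hc⟩, key h A hA c hc⟩

theorem range_projAction :
    (projAction ψ).range = Subgroup.closure (quatPerms ψ (diagonals ∪ midpoints)) := by
  rw [MonoidHom.range_eq_map, ← conjSubgroup_eq_top, conjSubgroup, MonoidHom.map_closure,
    image_projAction]

theorem map_Gbar : (Gbar k).map (conicEquiv ψ).symm.permCongrHom.toMonoidHom =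
    (projAction ψ).range := by
  rw [range_projAction, Gbar, MonoidHom.map_closure,
    ← image_isInduced ψ (S := fun a b => a ≠ b) subset_rfl (fun _ _ => exists_realizes k)
      (fun _ => exists_realizes_of_mem k)]
  rfl

/-- The identification of the group generated by the induced transformations of the conic with
`F(ℤ[1/3])`. -/
def gbarEquiv : Gbar k ≃* F ZThird :=
  (((conicEquiv ψ).symm.permCongrHom.subgroupMap (Gbar k)).trans
    (MulEquiv.subgroupCongr (map_Gbar ψ))).trans
      (MonoidHom.ofInjective (projAction_injective ψ)).symm

theorem projAction_gbarEquiv (g : Gbar k) :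
    projAction ψ (gbarEquiv ψ g) = (conicEquiv ψ).symm.permCongr (g : Equiv.Perm (conic k)) := by
  have h : MonoidHom.ofInjective (projAction_injective ψ) (gbarEquiv ψ g) =
      MulEquiv.subgroupCongr (map_Gbar ψ)
        ((conicEquiv ψ).symm.permCongrHom.subgroupMap (Gbar k) g) :=
    MulEquiv.apply_symm_apply _ _
  exact congrArg Subtype.val h

end Group

end CobleHessian

end

open CobleHessian
theorem theorem5p7 (k : Type*) [Field k] [IsAlgClosed k] [CharZero k] :
    (∀ a b : Fin 5, a ≠ b → ∃! g : Equiv.Perm (conic k), IsInduced a b g) ∧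
    Nonempty (k ⊗[ℤ] Hurwitz ≃ₐ[k] M₂ k) ∧
    Nonempty (ℚ_[3] ⊗[ℤ] Hurwitz ≃ₐ[ℚ_[3]] M₂ ℚ_[3]) ∧
    ∀ ψ : k ⊗[ℤ] Hurwitz ≃ₐ[k] M₂ k,
      ∃ φ : ℙ k (Fin 2 → k) ≃ conic k, IsConicIso φ ∧
        φ.symm.permCongr '' {g | ∃ a : Fin 5, a ≠ 4 ∧ IsInduced a 4 g} =
          quatPerms ψ diagonals ∧
        φ.symm.permCongr '' {g | ∃ a b : Fin 5, a ≠ 4 ∧ b ≠ 4 ∧ a ≠ b ∧ IsInduced a b g} =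
          quatPerms ψ midpoints ∧
        ∃ e : Gbar k ≃* F ZThird,
          (∀ g : Gbar k,
            φ.symm.permCongr (g : Equiv.Perm (conic k)) = pglPerm k (toPGL ψ (e g))) ∧
          ∀ ψ₃ : ℚ_[3] ⊗[ℤ] Hurwitz ≃ₐ[ℚ_[3]] M₂ ℚ_[3],
            Function.Injective (toPGL ψ₃) ∧
            Maximal (fun Γ : Subgroup PGL(2, ℚ_[3]) => DiscreteTopology Γ)
              ((toPGL ψ₃).comp e.toMonoidHom).range := by
  obtain ⟨ψ₀⟩ := nonempty_splitting_of_isAlgClosed k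
  refine ⟨fun a b hab => existsUnique_isInduced ψ₀ hab, ⟨ψ₀⟩, nonempty_splitting_padic, fun ψ =>
    ⟨conicEquiv ψ, isConicIso_conicEquiv ψ, ?_, ?_, gbarEquiv ψ,
      fun g => (projAction_gbarEquiv ψ g).symm, fun ψ₃ => ⟨toPGL_injective ψ₃, ?_⟩⟩⟩
  · rw [← image_isInduced ψ (S := fun a b => a ≠ 4 ∧ b = 4) Set.subset_union_left
      (by rintro a b ⟨ha, rfl⟩; exact exists_realizes_diagonal k ha)
      (fun h hh => (exists_realizes_of_mem_diagonals k hh).imp fun a ha => ⟨4, ⟨ha.1, rfl⟩, ha.2⟩)]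
    congr 1
    ext g
    simp
  · rw [← image_isInduced ψ (S := fun a b => a ≠ 4 ∧ b ≠ 4 ∧ a ≠ b) Set.subset_union_right
      (fun a b h => exists_realizes_midpoint k h.1 h.2.1 h.2.2)
      (fun h hh => by simpa only [and_assoc] using exists_realizes_of_mem_midpoints k hh)]
    simp only [and_assoc]
  · rw [MonoidHom.range_comp, MonoidHom.range_eq_top.2 (gbarEquiv ψ).surjective,
      ← MonoidHom.range_eq_map]
    exact maximal_range_toPGL ψ₃
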